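/- For $u:\mathbb{C}\to\mathbb{C}$ let $u_x,u_y$ denote the generalized (weak) partial derivatives, $z=x+iy$, and put $u_z=(u_x-iu_y)/2$, $u_{\bar z}=(u_x+iu_y)/2$. For $p\ge 1$ the class $W^{1,p}_{loc}$ consists of all $u\in L^p_{loc}(\mathbb{C})$ that have weak partial derivatives $u_x,u_y\in L^p_{loc}(\mathbb{C})$. Let $f:\mathbb{C}\to\mathbb{C}$ be a sense-preserving homeomorphism of $\mathbb{C}$ onto an open set $f(\mathbb{C})\subseteq\mathbb{C}$ (in particular, possibly, onto $\mathbb{C}$) that is regular, i.e. $f\in W^{1,1}_{loc}$ and $J_f=|f_z|^2-|f_{\bar z}|^2>0$ a.e. Here sense-preserving means that for every circle with center $c$, described once counterclockwise, the image curve has winding number $+1$ about $f(c)$. Let $\mu_f=f_{\bar z}/f_z$ where $f_z\neq 0$ and $\mu_f=0$ where $f_z=0$, and assume that $$K_{\mu_f}=\frac{1+|\mu_f|}{1-|\mu_f|}\in L^1_{loc}(\mathbb{C}).$$ Then, for every $g:\mathbb{C}\to\mathbb{C}$ of class $W^{1,2}_{loc}$, the composition $g\circ f$ belongs to $W^{1,1}_{loc}$,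 and a.e. in $\mathbb{C}$ $$(g\circ f)_{z}=(g_{w}\circ f)\,f_{z}+(g_{\bar w}\circ f)\,\overline{f_{\bar z}},\qquad (g\circ f)_{\bar z}=(g_{w}\circ f)\,f_{\bar z}+(g_{\bar w}\circ f)\,\overline{f_{z}}.$$ -/

import Mathlib

open MeasureTheory
open scoped ENNReal ContDiff ComplexConjugate

noncomputable section

namespace Beltrami

/-- `u'` is a generalized (weak) derivative of `u : ℂ → ℂ` in the real direction `v`:
`∫ u ∂_v η = - ∫ u' η` for all real test functions `η ∈ C_0^∞(ℂ)`. -/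
structure HasWeakDeriv (v : ℂ) (u u' : ℂ → ℂ) : Prop where
  locInt : LocallyIntegrable u
  locInt' : LocallyIntegrable u'
  integral_eq : ∀ η : ℂ → ℝ, ContDiff ℝ ∞ η → HasCompactSupport η →
    ∫ z, (fderiv ℝ η z v) • u z = - ∫ z, η z • u' z

/-- `u ∈ L^p_loc(ℂ)`. -/
def MemLpLoc (p : ℝ≥0∞) (u : ℂ → ℂ) : Prop :=
  ∀ K : Set ℂ, IsCompact K → MemLp u p (volume.restrict K)

/-- `u ∈ W^{1,p}_loc(ℂ)`: `u` is in `L^p_loc` and has weak partial derivatives `u_x`, `u_y`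
in `L^p_loc`. -/
def MemW1Loc (p : ℝ≥0∞) (u : ℂ → ℂ) : Prop :=
  MemLpLoc p u ∧ ∃ ux uy : ℂ → ℂ, MemLpLoc p ux ∧ MemLpLoc p uy ∧
    HasWeakDeriv 1 u ux ∧ HasWeakDeriv Complex.I u uy

open Classical in
/-- A representative of the weak derivative of `u` in the direction `v`; the weak derivative is
unique up to a null set. The value is `0` if `u` has no weak derivative in the direction `v`. -/
def weakDeriv (v : ℂ) (u : ℂ → ℂ) : ℂ → ℂ :=
  if h : ∃ u', HasWeakDeriv v u u' then h.choose else 0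

/-- `u_z = (u_x - i u_y) / 2`. -/
def dz (u : ℂ → ℂ) (z : ℂ) : ℂ :=
  (weakDeriv 1 u z - Complex.I * weakDeriv Complex.I u z) / 2

/-- `u_{z̄} = (u_x + i u_y) / 2`. -/
def dzbar (u : ℂ → ℂ) (z : ℂ) : ℂ :=
  (weakDeriv 1 u z + Complex.I * weakDeriv Complex.I u z) / 2

/-- The Jacobian `J_f = |f_z|² - |f_{z̄}|²`. -/
def jacobian (f : ℂ → ℂ) (z : ℂ) : ℝ :=
  ‖dz f z‖ ^ 2 - ‖dzbar f z‖ ^ 2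

/-- The complex characteristic `μ_f`, equal to `f_{z̄} / f_z` where `f_z ≠ 0` and to `0` where
`f_z = 0`. -/
def complexCharacteristic (f : ℂ → ℂ) (z : ℂ) : ℂ :=
  open Classical in if dz f z ≠ 0 then dzbar f z / dz f z else 0

/-- The dilatation `K_{μ_f} = (1 + |μ_f|) / (1 - |μ_f|)`. It is used for maps with `J_f > 0` a.e.,
for which `|μ_f| < 1` a.e. -/
def dilatation (f : ℂ → ℂ) (z : ℂ) : ℝ :=
  (1 + ‖complexCharacteristic f z‖) / (1 - ‖complexCharacteristic f z‖)

/-- An injective continuous `f : ℂ → ℂ` is sense-preserving if it maps every positively oriented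
circle to a curve of winding number `+1` about the image of the centre; `φ` is a continuous
branch of the argument of `f - f c` along the circle. -/
def SensePreserving (f : ℂ → ℂ) : Prop :=
  ∀ (c : ℂ) (r : ℝ), 0 < r → ∃ φ : ℝ → ℝ, Continuous φ ∧
    (∀ θ : ℝ, f (circleMap c r θ) - f c =
      (‖f (circleMap c r θ) - f c‖ : ℂ) * Complex.exp (Complex.I * (φ θ : ℂ))) ∧
    φ (2 * Real.pi) - φ 0 = 2 * Real.pi

/-- A regular homeomorphism of `ℂ` onto an open set `f(ℂ) ⊆ ℂ` (possibly all of `ℂ`): a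
homeomorphism of class `W^{1,1}_loc` with `J_f > 0` a.e. -/
structure IsRegularHomeo (f : ℂ → ℂ) : Prop where
  homeo : Topology.IsOpenEmbedding f
  sobolev : MemW1Loc 1 f
  jacobian_pos : ∀ᵐ z : ℂ, 0 < jacobian f z

end Beltrami

end

/-!
The weak derivative of a map `u : ℂ → ℂ` is encoded as a field `D` of real-linear maps
(`HasWeakFDeriv`), so that the two formulas to be proved become the single chain rule
`D(g ∘ f)(z) = Dg(f z) ∘ Df(z)`.

The proof approximates `g` by its mollifications `gₙ`. For each of them the chain rule is
`HasWeakFDeriv.contDiff_comp`. The passage to the limit rests on three facts.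

* The area inequality `∫_A |det Df| ≤ |f(A)|` (`withDensity_det_le_comap`). By the Poincaré
  inequality and the Lebesgue differentiation theorem, almost all of the plane is covered by
  countably many sets on which `f` is as close as desired to a linear map. On such a set the
  expansion of area by `f` is known. As `J_f > 0` almost everywhere, it follows that the preimages
  under `f` of null sets are null; hence `gₙ ∘ f → g ∘ f` almost everywhere.
* The dilatation satisfies `|Df|² ≤ K J_f`. The Cauchy–Schwarz inequality and the area inequality
  thus give
  `∫_B |(Dgₙ - Dg) ∘ f| |Df| ≤ (∫_{f(B)} |Dgₙ - Dg|²)^{1/2} (∫_B K)^{1/2}`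
  (`setLIntegral_comp_mul_enorm_le`), so that the derivatives of `gₙ ∘ f` converge in `L^1_loc`.
* Convergence almost everywhere together with convergence of the derivatives in `L^1_loc` implies
  that the limit is locally integrable and has the expected weak derivative
  (`hasWeakFDeriv_of_ae_tendsto`), again by the Poincaré inequality.
-/

namespace Beltrami

open Filter Topology Metric Set
open scoped NNReal

/-! ### Weak derivatives as linear maps -/

/-- `D` is the full weak derivative of `u : ℂ → ℂ`: the value `D z` is a real-linear map, whose
value at `v` is the weak derivative in the direction `v`. -/
structure HasWeakFDeriv (u : ℂ → ℂ) (D : ℂ → ℂ →L[ℝ] ℂ) : Prop where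
  locInt : LocallyIntegrable u
  locInt' : LocallyIntegrable D
  integral_eq : ∀ (v : ℂ) (η : ℂ → ℝ), ContDiff ℝ ∞ η → HasCompactSupport η →
    ∫ z, (fderiv ℝ η z v) • u z = - ∫ z, η z • D z v

/-- Convergence in `L^p` on every ball, hence on every compact set. -/
def TendstoLpLoc {E : Type*} [NormedAddCommGroup E] (p : ℝ≥0∞) (F : ℕ → ℂ → E) (f : ℂ → E) :
    Prop :=
  ∀ R : ℝ, Tendsto (fun n => eLpNorm (F n - f) p (volume.restrict (closedBall 0 R))) atTop (𝓝 0)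

variable {E : Type*} [NormedAddCommGroup E] [NormedSpace ℝ E]

theorem locallyIntegrable_iff_closedBall {F : Type*} [NormedAddCommGroup F] {h : ℂ → F} :
    LocallyIntegrable h ↔ ∀ R : ℝ, IntegrableOn h (closedBall 0 R) := by
  rw [locallyIntegrable_iff]
  refine ⟨fun H R => H _ (isCompact_closedBall 0 R), fun H K hK => ?_⟩
  obtain ⟨R, hR⟩ := hK.isBounded.subset_closedBall 0
  exact (H R).mono_set hR

theorem memLpLoc_one_iff {u : ℂ → ℂ} : MemLpLoc 1 u ↔ LocallyIntegrable u := by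
  rw [locallyIntegrable_iff]
  exact forall₂_congr fun K _ => memLp_one_iff_integrable

theorem continuous_fderiv_apply_const {F : Type*} [NormedAddCommGroup F] [NormedSpace ℝ F]
    {η : ℂ → F} (hη : ContDiff ℝ ∞ η) (v : ℂ) :
    Continuous fun z => fderiv ℝ η z v :=
  (hη.continuous_fderiv (by simp)).clm_apply continuous_const

theorem _root_.MeasureTheory.LocallyIntegrable.clm_apply {D : ℂ → ℂ →L[ℝ] ℂ}
    (hD : LocallyIntegrable D) (v : ℂ) : LocallyIntegrable fun z => D z v := by
  rw [locallyIntegrable_iff] at hD ⊢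
  exact fun K hK => (ContinuousLinearMap.apply ℝ ℂ v).integrable_comp (hD K hK)

namespace HasWeakFDeriv

variable {u w : ℂ → ℂ} {D D' : ℂ → ℂ →L[ℝ] ℂ}

theorem hasWeakDeriv (h : HasWeakFDeriv u D) (v : ℂ) : HasWeakDeriv v u fun z => D z v :=
  ⟨h.locInt, h.locInt'.clm_apply v, h.integral_eq v⟩

theorem sub (h : HasWeakFDeriv u D) (h' : HasWeakFDeriv w D') :
    HasWeakFDeriv (u - w) (D - D') := by
  refine ⟨h.locInt.sub h'.locInt, h.locInt'.sub h'.locInt', fun v η hη hc => ?_⟩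
  have h1 := continuous_fderiv_apply_const hη v
  have h2 := hc.fderiv_apply ℝ v
  simp only [Pi.sub_apply, smul_sub, sub_apply]
  rw [integral_sub (h.locInt.integrable_smul_left_of_hasCompactSupport h1 h2)
    (h'.locInt.integrable_smul_left_of_hasCompactSupport h1 h2),
    integral_sub ((h.locInt'.clm_apply v).integrable_smul_left_of_hasCompactSupport hη.continuous hc)
    ((h'.locInt'.clm_apply v).integrable_smul_left_of_hasCompactSupport hη.continuous hc),
    h.integral_eq v η hη hc, h'.integral_eq v η hη hc]
  ring

end HasWeakFDeriv

theorem hasWeakFDeriv_of_contDiff {u : ℂ → ℂ} (hu : ContDiff ℝ 1 u) :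
    HasWeakFDeriv u (fderiv ℝ u) := by
  have hD : Continuous (fderiv ℝ u) := hu.continuous_fderiv (by simp)
  refine ⟨hu.continuous.locallyIntegrable, hD.locallyIntegrable, fun v η hη hc => ?_⟩
  have h1 := continuous_fderiv_apply_const hη v
  have h2 := hc.fderiv_apply ℝ v
  have := integral_smul_fderiv_eq_neg_fderiv_smul_of_integrable (μ := (volume : Measure ℂ))
    (f := η) (g := u) (v := v)
    (hu.continuous.locallyIntegrable.integrable_smul_left_of_hasCompactSupport h1 h2)
    ((hD.locallyIntegrable.clm_apply v).integrable_smul_left_of_hasCompactSupport hη.continuous hc)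
    (hu.continuous.locallyIntegrable.integrable_smul_left_of_hasCompactSupport hη.continuous hc)
    (fun z _ => hη.differentiable (by simp) z) (fun z _ => hu.differentiable (by simp) z)
  rw [this, neg_neg]

/-- Weak derivatives are unique up to null sets. -/
theorem HasWeakDeriv.ae_eq {v : ℂ} {u a b : ℂ → ℂ} (ha : HasWeakDeriv v u a)
    (hb : HasWeakDeriv v u b) : a =ᵐ[volume] b := by
  have h0 : ∀ᵐ z, (a - b) z = 0 := by
    refine ae_eq_zero_of_integral_contDiff_smul_eq_zero (ha.locInt'.sub hb.locInt')
      fun η hη hc => ?_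
    simp only [Pi.sub_apply, smul_sub]
    rw [integral_sub (ha.locInt'.integrable_smul_left_of_hasCompactSupport hη.continuous hc)
      (hb.locInt'.integrable_smul_left_of_hasCompactSupport hη.continuous hc), sub_eq_zero, ← neg_inj,
      ← ha.integral_eq η hη hc, hb.integral_eq η hη hc]
  filter_upwards [h0] with z hz using sub_eq_zero.1 hz

theorem HasWeakDeriv.weakDeriv {v : ℂ} {u a : ℂ → ℂ} (ha : HasWeakDeriv v u a) :
    HasWeakDeriv v u (weakDeriv v u) := by
  have h : ∃ u', HasWeakDeriv v u u' := ⟨a, ha⟩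
  rw [Beltrami.weakDeriv, dif_pos h]
  exact h.choose_spec

/-- The real-linear map of `ℂ` that takes `1` to `a` and `I` to `b`. -/
noncomputable def linOf (a b : ℂ) : ℂ →L[ℝ] ℂ :=
  Complex.reCLM.smulRight a + Complex.imCLM.smulRight b

theorem linOf_apply (a b v : ℂ) : linOf a b v = v.re • a + v.im • b := rfl

theorem linOf_eq (a b : ℂ) : linOf a b =
    ContinuousLinearMap.smulRightL ℝ ℂ ℂ Complex.reCLM a +
      ContinuousLinearMap.smulRightL ℝ ℂ ℂ Complex.imCLM b := rfl

theorem continuous_linOf : Continuous fun p : ℂ × ℂ => linOf p.1 p.2 := by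
  simp only [linOf_eq]; fun_prop

theorem norm_linOf_le (a b : ℂ) : ‖linOf a b‖ ≤ ‖a‖ + ‖b‖ := by
  refine ContinuousLinearMap.opNorm_le_bound _ (by positivity) fun v => ?_
  rw [linOf_apply, add_mul]
  refine (norm_add_le _ _).trans ?_
  rw [norm_smul, norm_smul, mul_comm, mul_comm ‖v.im‖]
  gcongr
  · exact Complex.abs_re_le_norm v
  · exact Complex.abs_im_le_norm v

theorem eLpNorm_linOf_le {p : ℝ≥0∞} (hp : 1 ≤ p) {μ : Measure ℂ} {a b : ℂ → ℂ}
    (ha : AEStronglyMeasurable a μ) (hb : AEStronglyMeasurable b μ) :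
    eLpNorm (fun z => linOf (a z) (b z)) p μ ≤ eLpNorm a p μ + eLpNorm b p μ := by
  refine (eLpNorm_mono_real (g := fun z => ‖a z‖ + ‖b z‖) fun z => norm_linOf_le _ _).trans ?_
  refine (eLpNorm_add_le ha.norm hb.norm hp).trans_eq ?_
  rw [eLpNorm_norm, eLpNorm_norm]

theorem memLp_linOf {p : ℝ≥0∞} (hp : 1 ≤ p) {μ : Measure ℂ} {a b : ℂ → ℂ}
    (ha : MemLp a p μ) (hb : MemLp b p μ) : MemLp (fun z => linOf (a z) (b z)) p μ :=
  ⟨continuous_linOf.comp_aestronglyMeasurable (g := fun p : ℂ × ℂ => linOf p.1 p.2)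
    (f := fun z => (a z, b z)) (ha.1.prodMk hb.1),
    (eLpNorm_linOf_le hp ha.1 hb.1).trans_lt (ENNReal.add_lt_top.2 ⟨ha.2, hb.2⟩)⟩

theorem HasWeakDeriv.hasWeakFDeriv {u a b : ℂ → ℂ} (ha : HasWeakDeriv 1 u a)
    (hb : HasWeakDeriv Complex.I u b) : HasWeakFDeriv u fun z => linOf (a z) (b z) := by
  refine ⟨ha.locInt, ?_, fun v η hη hc => ?_⟩
  · rw [locallyIntegrable_iff]
    intro K hK
    exact memLp_one_iff_integrable.1 (memLp_linOf le_rfl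
      (memLp_one_iff_integrable.2 (ha.locInt'.integrableOn_isCompact hK))
      (memLp_one_iff_integrable.2 (hb.locInt'.integrableOn_isCompact hK)))
  · have hv : ∀ z, fderiv ℝ η z v =
        v.re • fderiv ℝ η z 1 + v.im • fderiv ℝ η z Complex.I := fun z => by
      rw [← map_smul, ← map_smul, ← map_add]
      congr 1
      apply Complex.ext <;> simp
    have i1 := ha.locInt.integrable_smul_left_of_hasCompactSupport
      (continuous_fderiv_apply_const hη 1) (hc.fderiv_apply ℝ 1)
    have i2 := ha.locInt.integrable_smul_left_of_hasCompactSupport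
      (continuous_fderiv_apply_const hη Complex.I) (hc.fderiv_apply ℝ Complex.I)
    have i3 := ha.locInt'.integrable_smul_left_of_hasCompactSupport hη.continuous hc
    have i4 := hb.locInt'.integrable_smul_left_of_hasCompactSupport hη.continuous hc
    simp only [hv, linOf_apply, add_smul, smul_add, smul_assoc]
    simp_rw [smul_comm _ v.re, smul_comm _ v.im]
    have j1 : Integrable fun z => v.re • fderiv ℝ η z 1 • u z := i1.smul v.re
    have j2 : Integrable fun z => v.im • fderiv ℝ η z Complex.I • u z := i2.smul v.im
    have j3 : Integrable fun z => v.re • η z • a z := i3.smul v.re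
    have j4 : Integrable fun z => v.im • η z • b z := i4.smul v.im
    rw [integral_add j1 j2, integral_add j3 j4,
      integral_smul, integral_smul, integral_smul, integral_smul, ha.integral_eq η hη hc,
      hb.integral_eq η hη hc, smul_neg, smul_neg, neg_add]

theorem TendstoLpLoc.eventually_eLpNorm_sub_lt_top {V : Type*} [NormedAddCommGroup V]
    {F : ℕ → ℂ → V} {f : ℂ → V}
    (h : TendstoLpLoc 1 F f) (R : ℝ) :
    ∀ᶠ n in atTop, eLpNorm (F n - f) 1 (volume.restrict (closedBall 0 R)) < ⊤ :=
  (h R).eventually (gt_mem_nhds ENNReal.zero_lt_top)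

/-- The limit in `L^1_loc` of locally integrable functions is locally integrable. -/
theorem TendstoLpLoc.locallyIntegrable {V : Type*} [NormedAddCommGroup V]
    {F : ℕ → ℂ → V} {f : ℂ → V}
    (h : TendstoLpLoc 1 F f) (hF : ∀ n, LocallyIntegrable (F n))
    (hf : AEStronglyMeasurable f) : LocallyIntegrable f := by
  rw [locallyIntegrable_iff_closedBall]
  intro R
  obtain ⟨n, hn⟩ := (h.eventually_eLpNorm_sub_lt_top R).exists
  have h1 := (locallyIntegrable_iff_closedBall.1 (hF n) R)
  have h2 : IntegrableOn (F n - f) (closedBall 0 R) :=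
    memLp_one_iff_integrable.1 ⟨h1.1.sub hf.restrict, hn⟩
  simpa using h1.sub h2

theorem TendstoLpLoc.tendsto_integral_smul {F : ℕ → ℂ → E} {f : ℂ → E}
    (h : TendstoLpLoc 1 F f) (hF : ∀ n, LocallyIntegrable (F n)) (hf : LocallyIntegrable f)
    {η : ℂ → ℝ} (hη : Continuous η) (hc : HasCompactSupport η) :
    Tendsto (fun n => ∫ z, η z • F n z) atTop (𝓝 (∫ z, η z • f z)) := by
  refine tendsto_integral_of_L1 _ (hf.integrable_smul_left_of_hasCompactSupport hη hc).1
    (.of_forall fun n => (hF n).integrable_smul_left_of_hasCompactSupport hη hc) ?_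
  obtain ⟨R, hR⟩ := hc.isCompact.isBounded.subset_closedBall 0
  obtain ⟨C, hC⟩ := hη.bounded_above_of_compact_support hc
  have hlim := ENNReal.Tendsto.const_mul (a := ENNReal.ofReal C) (h R) (Or.inr ENNReal.ofReal_ne_top)
  rw [mul_zero] at hlim
  refine tendsto_of_tendsto_of_tendsto_of_le_of_le tendsto_const_nhds hlim (fun _ => zero_le)
    fun n => ?_
  rw [eLpNorm_one_eq_lintegral_enorm, ← lintegral_const_mul' _ _ ENNReal.ofReal_ne_top,
    ← lintegral_indicator isClosed_closedBall.measurableSet]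
  refine lintegral_mono fun z => ?_
  by_cases hz : z ∈ closedBall (0 : ℂ) R
  · rw [indicator_of_mem hz, ← smul_sub, enorm_smul]
    gcongr
    · rw [← ofReal_norm]
      exact ENNReal.ofReal_le_ofReal (hC z)
    · rfl
  · have : η z = 0 := image_eq_zero_of_notMem_tsupport fun h => hz (hR h)
    simp [this]

theorem TendstoLpLoc.clm_apply {F : ℕ → ℂ → ℂ →L[ℝ] ℂ} {D : ℂ → ℂ →L[ℝ] ℂ}
    (h : TendstoLpLoc 1 F D) (v : ℂ) :
    TendstoLpLoc 1 (fun n z => F n z v) (fun z => D z v) := by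
  intro R
  have hlim := ENNReal.Tendsto.const_mul (a := ‖v‖ₑ) (h R) (Or.inr enorm_ne_top)
  rw [mul_zero] at hlim
  refine tendsto_of_tendsto_of_tendsto_of_le_of_le tendsto_const_nhds hlim (fun _ => zero_le)
    fun n => ?_
  simp only [eLpNorm_one_eq_lintegral_enorm]
  rw [← lintegral_const_mul' _ _ enorm_ne_top]
  refine lintegral_mono fun z => ?_
  simp only [Pi.sub_apply, ← sub_apply]
  rw [mul_comm]
  exact ContinuousLinearMap.le_opENorm _ _

/-- Weak derivatives are closed under convergence in `L^1_loc`. -/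
theorem hasWeakFDeriv_of_tendstoLpLoc {F : ℕ → ℂ → ℂ} {G : ℕ → ℂ → ℂ →L[ℝ] ℂ} {u : ℂ → ℂ}
    {D : ℂ → ℂ →L[ℝ] ℂ} (h : ∀ n, HasWeakFDeriv (F n) (G n)) (hu : LocallyIntegrable u)
    (hD : LocallyIntegrable D) (hF : TendstoLpLoc 1 F u) (hG : TendstoLpLoc 1 G D) :
    HasWeakFDeriv u D := by
  refine ⟨hu, hD, fun v η hη hc => ?_⟩
  have h1 := hF.tendsto_integral_smul (fun n => (h n).locInt) hu
    (continuous_fderiv_apply_const hη v) (hc.fderiv_apply ℝ v)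
  have h2 := (hG.clm_apply v).tendsto_integral_smul (fun n => (h n).locInt'.clm_apply v)
    (hD.clm_apply v) hη.continuous hc
  refine tendsto_nhds_unique h1 (h2.neg.congr fun n => ?_)
  rw [(h n).integral_eq v η hη hc]

/-! ### Mollification -/

/-- Translations are continuous in `L^p`. -/
theorem tendsto_eLpNorm_translate_sub {V : Type*} [NormedAddCommGroup V] {p : ℝ≥0∞}
    (hp1 : 1 ≤ p) (hp : p ≠ ⊤) {h : ℂ → V}
    (hh : MemLp h p) :
    Tendsto (fun t : ℂ => eLpNorm (fun x => h (x - t) - h x) p volume) (𝓝 0) (𝓝 0) := by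
  have : Fact (1 ≤ p) := ⟨hp1⟩
  let g : C(ℂ, C(ℂ, ℂ)) := (ContinuousMap.mk (fun a : ℂ × ℂ => a.2 - a.1)).curry
  have hg : ∀ t, MeasurePreserving (g t) (volume : Measure ℂ) volume := fun t =>
    measurePreserving_sub_right volume t
  have hlim := ((continuous_const (y := hh.toLp h)).compMeasurePreservingLp g.continuous hg
    hp).tendsto (0 : ℂ)
  rw [Lp.tendsto_Lp_iff_tendsto_eLpNorm'] at hlim
  refine hlim.congr fun t => ?_
  refine eLpNorm_congr_ae ?_
  have e0 := hh.coeFn_toLp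
  have e1 := Lp.coeFn_compMeasurePreserving (hh.toLp h) (hg t)
  have e2 := Lp.coeFn_compMeasurePreserving (hh.toLp h) (hg 0)
  filter_upwards [e1, e2, e0, (hg t).quasiMeasurePreserving.ae e0] with x h1 h2 h3 h4
  simp only [Pi.sub_apply, h1, h2, Function.comp]
  rw [h4]
  have : g 0 x = x := sub_zero x
  rw [this, h3]
  rfl

/-- Jensen's inequality for the average against a bump function. -/
theorem enorm_integral_smul_rpow_le (φ : ContDiffBump (0 : ℂ)) {q : ℝ} (hq : 1 ≤ q) {k : ℂ → E}
    (hk : AEStronglyMeasurable k) :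
    ‖∫ t, φ.normed volume t • k t‖ₑ ^ q ≤
      ∫⁻ t, ENNReal.ofReal (φ.normed volume t) * ‖k t‖ₑ ^ q := by
  have hm : Measurable fun t => ENNReal.ofReal (φ.normed volume t) :=
    (φ.continuous_normed (μ := volume)).measurable.ennreal_ofReal
  let ν : Measure ℂ := volume.withDensity fun t => ENNReal.ofReal (φ.normed volume t)
  have hν : IsProbabilityMeasure ν := ⟨by
    simp only [ν, withDensity_apply _ MeasurableSet.univ, Measure.restrict_univ]
    rw [← ofReal_integral_eq_lintegral_ofReal φ.integrable_normed
      (.of_forall fun t => φ.nonneg_normed t), φ.integral_normed, ENNReal.ofReal_one]⟩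
  have hkν : AEStronglyMeasurable k ν := hk.mono_ac (withDensity_absolutelyContinuous _ _)
  have h1 : ‖∫ t, φ.normed volume t • k t‖ₑ ≤ eLpNorm' k 1 ν := by
    refine (enorm_integral_le_lintegral_enorm _).trans_eq ?_
    rw [eLpNorm'_eq_lintegral_enorm]
    simp only [ENNReal.rpow_one, div_one]
    rw [lintegral_withDensity_eq_lintegral_mul₀ hm.aemeasurable hk.enorm]
    refine lintegral_congr fun t => ?_
    rw [enorm_smul, Real.enorm_of_nonneg (φ.nonneg_normed t)]
    rfl
  have h2 := h1.trans (eLpNorm'_le_eLpNorm'_of_exponent_le one_pos hq ν hkν)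
  refine (ENNReal.rpow_le_rpow h2 (by linarith)).trans_eq ?_
  rw [eLpNorm'_eq_lintegral_enorm, ← ENNReal.rpow_mul, one_div_mul_cancel (by linarith),
    ENNReal.rpow_one, lintegral_withDensity_eq_lintegral_mul₀ hm.aemeasurable (hk.enorm.pow_const q)]
  rfl

/-- The `n`-th bump function of a standard sequence shrinking to the origin. -/
noncomputable def bump (n : ℕ) : ContDiffBump (0 : ℂ) where
  rIn := 1 / (n + 1) / 2
  rOut := 1 / (n + 1)
  rIn_pos := by positivity
  rIn_lt_rOut := half_lt_self (by positivity)

theorem bump_rOut_le_one (n : ℕ) : (bump n).rOut ≤ 1 := by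
  change 1 / ((n : ℝ) + 1) ≤ 1
  rw [div_le_one (by positivity)]
  linarith [n.cast_nonneg (α := ℝ)]

theorem tendsto_bump_rOut : Tendsto (fun n => (bump n).rOut) atTop (𝓝 0) :=
  tendsto_one_div_add_atTop_nhds_zero_nat

/-- The kernel of the `n`-th mollification. -/
noncomputable def kernel (n : ℕ) : ℂ → ℝ := (bump n).normed volume

theorem contDiff_kernel (n : ℕ) : ContDiff ℝ ∞ (kernel n) := (bump n).contDiff_normed

theorem hasCompactSupport_kernel (n : ℕ) : HasCompactSupport (kernel n) :=
  (bump n).hasCompactSupport_normed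

theorem integral_kernel (n : ℕ) : ∫ t, kernel n t = 1 := (bump n).integral_normed

theorem kernel_nonneg (n : ℕ) (t : ℂ) : 0 ≤ kernel n t := (bump n).nonneg_normed t

theorem lintegral_kernel (n : ℕ) : ∫⁻ t, ENNReal.ofReal (kernel n t) = 1 := by
  rw [← ofReal_integral_eq_lintegral_ofReal (f := kernel n) (bump n).integrable_normed
    (.of_forall (kernel_nonneg n)), integral_kernel, ENNReal.ofReal_one]

theorem kernel_eq_zero {n : ℕ} {t : ℂ} (ht : 1 < ‖t‖) : kernel n t = 0 := by
  by_contra h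
  have : t ∈ Function.support ((bump n).normed volume) := h
  rw [(bump n).support_normed_eq, mem_ball_zero_iff] at this
  linarith [bump_rOut_le_one n]

/-- The `n`-th mollification of `h`. -/
noncomputable def mollify (n : ℕ) (h : ℂ → E) : ℂ → E :=
  convolution (kernel n) h (ContinuousLinearMap.lsmul ℝ ℝ) volume

theorem mollify_apply (n : ℕ) (h : ℂ → E) (x : ℂ) :
    mollify n h x = ∫ t, kernel n t • h (x - t) := rfl

theorem contDiff_mollify [CompleteSpace E] (n : ℕ) {h : ℂ → E} (hh : LocallyIntegrable h) :
    ContDiff ℝ ∞ (mollify n h) :=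
  (hasCompactSupport_kernel n).contDiff_convolution_left _ (contDiff_kernel n) hh

theorem mollify_sub_eq_integral [CompleteSpace E] (n : ℕ) {h : ℂ → E} (hh : LocallyIntegrable h)
    (x : ℂ) :
    mollify n h x - h x = ∫ t, kernel n t • (h (x - t) - h x) := by
  have i1 : Integrable fun t => kernel n t • h (x - t) :=
    (hasCompactSupport_kernel n).convolutionExists_left (ContinuousLinearMap.lsmul ℝ ℝ)
      (contDiff_kernel n).continuous hh x
  have i2 : Integrable fun t => kernel n t • h x := (bump n).integrable_normed.smul_const _
  simp only [smul_sub]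
  rw [integral_sub i1 i2, integral_smul_const, integral_kernel, one_smul, mollify_apply]

/-- Mollifications converge in `L^p`, by Jensen's inequality and the continuity of translations
in `L^p`. -/
theorem tendsto_eLpNorm_mollify_sub [CompleteSpace E] {p : ℝ≥0∞} (hp1 : 1 ≤ p) (hp : p ≠ ⊤)
    {h : ℂ → E} (hh : MemLp h p) :
    Tendsto (fun n => eLpNorm (mollify n h - h) p volume) atTop (𝓝 0) := by
  have hp0 : p ≠ 0 := (one_pos.trans_le hp1).ne'
  have hq : 1 ≤ p.toReal := by
    simpa using ENNReal.toReal_mono hp hp1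
  have hloc : LocallyIntegrable h := hh.locallyIntegrable hp1
  have key : ∀ (n : ℕ) (ε : ℝ≥0∞),
      (∀ t ∈ ball (0 : ℂ) (bump n).rOut, eLpNorm (fun x => h (x - t) - h x) p volume ≤ ε) →
      eLpNorm (mollify n h - h) p volume ≤ ε := by
    intro n ε hε
    rw [← ENNReal.rpow_le_rpow_iff (show 0 < p.toReal by linarith),
      eLpNorm_eq_eLpNorm' hp0 hp, eLpNorm'_eq_lintegral_enorm, ← ENNReal.rpow_mul,
      one_div_mul_cancel (by linarith), ENNReal.rpow_one]
    have hmeas : AEStronglyMeasurable (fun z : ℂ × ℂ => h (z.1 - z.2) - h z.1)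
        (volume.prod volume) :=
      (hh.1.comp_quasiMeasurePreserving (quasiMeasurePreserving_sub volume volume)).sub
        (hh.1.comp_fst)
    calc ∫⁻ x, ‖(mollify n h - h) x‖ₑ ^ p.toReal
        ≤ ∫⁻ x, ∫⁻ t, ENNReal.ofReal (kernel n t) * ‖h (x - t) - h x‖ₑ ^ p.toReal := by
          refine lintegral_mono_ae ?_
          filter_upwards [hmeas.prodMk_left] with x hx
          rw [Pi.sub_apply, mollify_sub_eq_integral n hloc x]
          exact enorm_integral_smul_rpow_le (bump n) hq hx
      _ = ∫⁻ t, ENNReal.ofReal (kernel n t) * ∫⁻ x, ‖h (x - t) - h x‖ₑ ^ p.toReal := by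
          rw [lintegral_lintegral_swap]
          · refine lintegral_congr fun t => ?_
            rw [lintegral_const_mul' _ _ ENNReal.ofReal_ne_top]
          · exact (((contDiff_kernel n).continuous.measurable.ennreal_ofReal.comp
              measurable_snd).aemeasurable).mul (hmeas.enorm.pow_const _)
      _ ≤ ∫⁻ t, ENNReal.ofReal (kernel n t) * ε ^ p.toReal := by
          refine lintegral_mono fun t => ?_
          by_cases ht : t ∈ ball (0 : ℂ) (bump n).rOut
          · refine mul_le_mul_right ?_ _
            have := ENNReal.rpow_le_rpow (hε t ht) (show 0 ≤ p.toReal by linarith)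
            rwa [eLpNorm_eq_eLpNorm' hp0 hp, eLpNorm'_eq_lintegral_enorm, ← ENNReal.rpow_mul,
              one_div_mul_cancel (by linarith), ENNReal.rpow_one] at this
          · have : kernel n t = 0 := by
              by_contra h
              exact ht ((bump n).support_normed_eq (μ := volume) ▸ h)
            simp [this]
      _ = ε ^ p.toReal := by
          rw [lintegral_mul_const _ (contDiff_kernel n).continuous.measurable.ennreal_ofReal,
            lintegral_kernel, one_mul]
  rw [ENNReal.tendsto_nhds_zero]
  intro ε hε
  have hev := (ENNReal.tendsto_nhds_zero.1 (tendsto_eLpNorm_translate_sub hp1 hp hh)) ε hε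
  obtain ⟨r, hr, hball⟩ := Metric.eventually_nhds_iff_ball.1 hev
  filter_upwards [tendsto_bump_rOut.eventually (gt_mem_nhds hr)] with n hn
  exact key n ε fun t ht => hball t (ball_subset_ball hn.le ht)

theorem tendstoLpLoc_mollify [CompleteSpace E] {p : ℝ≥0∞} (hp1 : 1 ≤ p) (hp : p ≠ ⊤)
    {h : ℂ → E} (hh : ∀ R : ℝ, MemLp h p (volume.restrict (closedBall 0 R))) :
    TendstoLpLoc p (fun n => mollify n h) h := by
  intro R
  set h' := (closedBall (0 : ℂ) (R + 1)).indicator h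
  have hh' : MemLp h' p := (memLp_indicator_iff_restrict isClosed_closedBall.measurableSet).2
    (hh (R + 1))
  refine tendsto_of_tendsto_of_tendsto_of_le_of_le tendsto_const_nhds
    (tendsto_eLpNorm_mollify_sub hp1 hp hh') (fun _ => zero_le) fun n => ?_
  refine le_trans (b := eLpNorm (mollify n h' - h') p (volume.restrict (closedBall 0 R)))
    (le_of_eq ?_) (eLpNorm_mono_measure _ Measure.restrict_le_self)
  refine eLpNorm_congr_ae ?_
  filter_upwards [ae_restrict_mem isClosed_closedBall.measurableSet] with x hx
  rw [mem_closedBall_zero_iff] at hx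
  simp only [Pi.sub_apply, mollify_apply]
  congr 1
  · refine integral_congr_ae (.of_forall fun t => ?_)
    by_cases ht : 1 < ‖t‖
    · simp [kernel_eq_zero ht]
    · have : x - t ∈ closedBall (0 : ℂ) (R + 1) := by
        rw [mem_closedBall_zero_iff]
        linarith [norm_sub_le x t]
      simp only [h', indicator_of_mem this]
  · have : x ∈ closedBall (0 : ℂ) (R + 1) := by
      rw [mem_closedBall_zero_iff]; linarith
    simp only [h', indicator_of_mem this]

theorem tendstoLpLoc_mollify_one [CompleteSpace E] {h : ℂ → E} (hh : LocallyIntegrable h) :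
    TendstoLpLoc 1 (fun n => mollify n h) h :=
  tendstoLpLoc_mollify le_rfl ENNReal.one_ne_top fun R => memLp_one_iff_integrable.2
    (locallyIntegrable_iff_closedBall.1 hh R)

theorem ae_tendsto_mollify [CompleteSpace E] {h : ℂ → E} (hh : LocallyIntegrable h) :
    ∀ᵐ x, Tendsto (fun n => mollify n h x) atTop (𝓝 (h x)) :=
  ContDiffBump.ae_convolution_tendsto_right_of_locallyIntegrable (K := 2) tendsto_bump_rOut
    (.of_forall fun n => by change 1 / ((n : ℝ) + 1) ≤ 2 * (1 / (n + 1) / 2); linarith) hh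

theorem tendsto_mollify [CompleteSpace E] {h : ℂ → E} (hh : Continuous h) (x : ℂ) :
    Tendsto (fun n => mollify n h x) atTop (𝓝 (h x)) :=
  ContDiffBump.convolution_tendsto_right_of_continuous tendsto_bump_rOut hh x

/-- Mollifications of a continuous function are bounded on balls, uniformly in the mollification
parameter. -/
theorem exists_norm_mollify_le {h : ℂ → E} (hh : Continuous h) (R : ℝ) :
    ∃ C, ∀ n, ∀ x ∈ closedBall (0 : ℂ) R, ‖mollify n h x‖ ≤ C := by
  obtain ⟨C, hC⟩ := (isCompact_closedBall (0 : ℂ) (R + 1)).exists_bound_of_continuousOn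
    hh.continuousOn
  refine ⟨C, fun n x hx => ?_⟩
  rw [mem_closedBall_zero_iff] at hx
  have : ‖mollify n h x‖ ≤ ∫ t, kernel n t * C := by
    refine norm_integral_le_of_norm_le ((bump n).integrable_normed.mul_const C)
      (.of_forall fun t => ?_)
    by_cases ht : 1 < ‖t‖
    · simp [kernel_eq_zero ht]
    · have : x - t ∈ closedBall (0 : ℂ) (R + 1) := by
        rw [mem_closedBall_zero_iff]
        linarith [norm_sub_le x t]
      have h0 : 0 ≤ kernel n t := kernel_nonneg n t
      rw [ContinuousLinearMap.lsmul_apply, norm_smul, Real.norm_of_nonneg h0]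
      exact mul_le_mul_of_nonneg_left (hC _ this) h0
  rwa [integral_mul_const, integral_kernel, one_mul] at this

/-- Mollification commutes with weak differentiation. -/
theorem HasWeakFDeriv.fderiv_mollify {u : ℂ → ℂ} {D : ℂ → ℂ →L[ℝ] ℂ} (h : HasWeakFDeriv u D)
    (n : ℕ) : fderiv ℝ (mollify n u) = mollify n D := by
  ext1 x
  have hd := (hasCompactSupport_kernel n).hasFDerivAt_convolution_left
    (ContinuousLinearMap.lsmul ℝ ℝ) ((contDiff_kernel n).of_le (by simp)) h.locInt x
  rw [show mollify n u = convolution (kernel n) u (ContinuousLinearMap.lsmul ℝ ℝ) volume from rfl,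
    hd.fderiv]
  have hcd : Continuous (fderiv ℝ (kernel n)) := (contDiff_kernel n).continuous_fderiv (by simp)
  have hex := ((hasCompactSupport_kernel n).fderiv (𝕜 := ℝ)).convolutionExists_left
    ((ContinuousLinearMap.lsmul ℝ ℝ : ℝ →L[ℝ] ℂ →L[ℝ] ℂ).precompL ℂ) hcd h.locInt x
  have hexD : Integrable fun t => kernel n t • D (x - t) :=
    (hasCompactSupport_kernel n).convolutionExists_left (ContinuousLinearMap.lsmul ℝ ℝ)
      (contDiff_kernel n).continuous h.locInt' x
  refine ContinuousLinearMap.ext fun v => ?_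
  rw [mollify_apply, ContinuousLinearMap.integral_apply hexD, convolution,
    ContinuousLinearMap.integral_apply hex]
  simp only [ContinuousLinearMap.precompL_apply, ContinuousLinearMap.lsmul_apply, smul_apply]
  rw [← integral_sub_left_eq_self _ volume x,
    ← integral_sub_left_eq_self (fun t => kernel n t • D (x - t) v) volume x]
  simp only [sub_sub_cancel]
  have hη : ContDiff ℝ ∞ fun s => kernel n (x - s) :=
    (contDiff_kernel n).comp (contDiff_const.sub contDiff_id)
  have hc : HasCompactSupport fun s => kernel n (x - s) :=
    (hasCompactSupport_kernel n).comp_homeomorph (Homeomorph.subLeft x)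
  have hf : ∀ s, fderiv ℝ (fun s => kernel n (x - s)) s v = - fderiv ℝ (kernel n) (x - s) v := by
    intro s
    have h1 : HasFDerivAt (kernel n) (fderiv ℝ (kernel n) (x - s)) (x - s) :=
      ((contDiff_kernel n).differentiable (by simp) _).hasFDerivAt
    have h2 := h1.comp s ((hasFDerivAt_id (𝕜 := ℝ) s).const_sub x)
    rw [show (fun s => kernel n (x - s)) = kernel n ∘ HSub.hSub x from rfl, h2.fderiv]
    simp
  have := h.integral_eq v _ hη hc
  simp only [hf, neg_smul, integral_neg, neg_inj] at this
  exact this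

/-! ### The Poincaré inequality -/

/-- Lebesgue measure on the closed disc with centre `c` and radius `r`. -/
noncomputable def discMeasure (c : ℂ) (r : ℝ) : Measure ℂ := volume.restrict (closedBall c r)

instance (c : ℂ) (r : ℝ) : IsFiniteMeasure (discMeasure c r) :=
  ⟨by simpa [discMeasure] using (isCompact_closedBall c r).measure_lt_top (μ := volume)⟩

theorem discMeasure_le (c : ℂ) (r : ℝ) : discMeasure c r ≤ volume := Measure.restrict_le_self

theorem ae_mem_discMeasure (c : ℂ) (r : ℝ) : ∀ᵐ z ∂discMeasure c r, z ∈ closedBall c r :=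
  ae_restrict_mem isClosed_closedBall.measurableSet

theorem discMeasure_univ (c : ℂ) (r : ℝ) : discMeasure c r univ = volume (closedBall c r) := by
  simp [discMeasure]

/-- The Poincaré inequality on the disc with centre `c` and radius `r`, for a function `u` with
derivative `D`. -/
def PoincareOn (c : ℂ) (r : ℝ) (u : ℂ → ℂ) (D : ℂ → ℂ →L[ℝ] ℂ) : Prop :=
  ∫⁻ p, ‖u p.1 - u p.2‖ₑ ∂(discMeasure c r).prod (discMeasure c r) ≤
    8 * ENNReal.ofReal r * volume (closedBall c r) * ∫⁻ z, ‖D z‖ₑ ∂discMeasure c r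

/-- The Poincaré inequality survives convergence of the functions almost everywhere and of the
derivatives in `L^1_loc`, by Fatou's lemma. -/
theorem poincareOn_of_tendsto {c : ℂ} {r : ℝ} {F : ℕ → ℂ → ℂ} {G : ℕ → ℂ → ℂ →L[ℝ] ℂ}
    {u : ℂ → ℂ} {D : ℂ → ℂ →L[ℝ] ℂ} (h : ∀ n, PoincareOn c r (F n) (G n))
    (hFm : ∀ n, AEStronglyMeasurable (F n))
    (hDm : AEStronglyMeasurable D)
    (hF : ∀ᵐ z, Tendsto (fun n => F n z) atTop (𝓝 (u z))) (hG : TendstoLpLoc 1 G D) :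
    PoincareOn c r u D := by
  set ν := discMeasure c r
  have hac : ν ≪ volume := (discMeasure_le c r).absolutelyContinuous
  have hF' := hac.ae_le hF
  have hFatou : ∫⁻ p, ‖u p.1 - u p.2‖ₑ ∂ν.prod ν ≤
      liminf (fun n => ∫⁻ p, ‖F n p.1 - F n p.2‖ₑ ∂ν.prod ν) atTop := by
    refine le_trans (lintegral_mono_ae ?_) (lintegral_liminf_le' fun n => ?_)
    · filter_upwards [Measure.quasiMeasurePreserving_fst.ae hF',
        Measure.quasiMeasurePreserving_snd.ae hF'] with p h1 h2
      exact ((h1.sub h2).enorm.liminf_eq).ge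
    · have := (hFm n).mono_ac hac
      exact (this.comp_fst.sub this.comp_snd).enorm
  have hlim : Tendsto (fun n => 8 * ENNReal.ofReal r * volume (closedBall c r) *
      (∫⁻ z, ‖D z‖ₑ ∂ν + ∫⁻ z, ‖G n z - D z‖ₑ ∂ν)) atTop
      (𝓝 (8 * ENNReal.ofReal r * volume (closedBall c r) * (∫⁻ z, ‖D z‖ₑ ∂ν + 0))) := by
    refine ENNReal.Tendsto.const_mul (tendsto_const_nhds.add ?_) (Or.inr ?_)
    · obtain ⟨R, hR⟩ := (isBounded_closedBall (x := c) (r := r)).subset_closedBall 0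
      have h1 := hG R
      simp only [eLpNorm_one_eq_lintegral_enorm] at h1
      exact tendsto_of_tendsto_of_tendsto_of_le_of_le tendsto_const_nhds h1 (fun _ => zero_le)
        fun n => lintegral_mono_set hR
    · exact ENNReal.mul_ne_top (ENNReal.mul_ne_top (by norm_num) ENNReal.ofReal_ne_top)
        (isCompact_closedBall c r).measure_lt_top.ne
  rw [add_zero] at hlim
  refine hFatou.trans (le_trans (liminf_le_liminf (.of_forall fun n => ?_)) hlim.liminf_eq.le)
  refine (h n).trans ?_
  gcongr
  rw [← lintegral_add_left' (hDm.mono_ac hac).enorm]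
  refine lintegral_mono fun z => ?_
  simpa using enorm_add_le (D z) (G n z - D z)

/-- The contraction `y ↦ s x + (1 - s) y` towards a point of a disc maps the disc into itself, with
Jacobian `(1 - s)² ≥ 1 / 4`. -/
theorem lintegral_comp_affine_le {c : ℂ} {r : ℝ} {F : ℂ → ℝ≥0∞} (hF : Measurable F) {x : ℂ}
    (hx : x ∈ closedBall c r) {s : ℝ} (hs0 : 0 ≤ s) (hs1 : s ≤ 1 / 2) :
    ∫⁻ y in closedBall c r, F (s • x + (1 - s) • y) ≤ 4 * ∫⁻ z in closedBall c r, F z := by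
  set B := closedBall c r
  have hB : MeasurableSet B := isClosed_closedBall.measurableSet
  have hs : (1 - s) ≠ 0 := by linarith
  have hG : Measurable (B.indicator F) := hF.indicator hB
  calc ∫⁻ y in B, F (s • x + (1 - s) • y)
      ≤ ∫⁻ y, B.indicator F (s • x + (1 - s) • y) := by
        rw [← lintegral_indicator hB]
        refine lintegral_mono fun y => ?_
        by_cases hy : y ∈ B
        · have : s • x + (1 - s) • y ∈ B :=
            convex_closedBall c r hx hy hs0 (by linarith) (by ring)
          rw [indicator_of_mem hy, indicator_of_mem this]
        · rw [indicator_of_notMem hy]; exact zero_le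
    _ = ∫⁻ z, B.indicator F (s • x + z) ∂(Measure.map ((1 - s) • ·) volume) := by
        rw [lintegral_map (f := fun z => B.indicator F (s • x + z))
          (hG.comp (measurable_const_add _)) (measurable_const_smul _)]
    _ = ENNReal.ofReal |((1 - s) ^ 2)⁻¹| * ∫⁻ z, B.indicator F z := by
        rw [Measure.map_addHaar_smul _ hs, lintegral_smul_measure, Complex.finrank_real_complex,
          lintegral_add_left_eq_self (B.indicator F)]
        rfl
    _ ≤ 4 * ∫⁻ z in B, F z := by
        rw [lintegral_indicator hB]
        gcongr
        rw [show (4 : ℝ≥0∞) = ENNReal.ofReal 4 by norm_num]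
        refine ENNReal.ofReal_le_ofReal ?_
        rw [abs_of_nonneg (by positivity)]
        refine inv_le_of_inv_le₀ (by norm_num) ?_
        nlinarith

/-- The distance from a point `y` of a disc to its midpoint with another point `x` is at most `r`;
the path from `y` to the midpoint has parameter `0 ≤ s ≤ 1 / 2`, which bounds the Jacobian in
`lintegral_comp_affine_le`. -/
theorem enorm_sub_midpoint_le {u : ℂ → ℂ} (hu : ContDiff ℝ 1 u) {c : ℂ} {r : ℝ} {x y : ℂ}
    (hx : x ∈ closedBall c r) (hy : y ∈ closedBall c r) :
    ‖u y - u ((1 / 2 : ℝ) • x + (1 / 2 : ℝ) • y)‖ₑ ≤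
      ENNReal.ofReal r * ∫⁻ s in Ioc (0 : ℝ) (1 / 2), 2 *
        ‖fderiv ℝ u (s • x + (1 - s) • y)‖ₑ := by
  have hD : Continuous (fderiv ℝ u) := hu.continuous_fderiv (by simp)
  have hpath : ∀ s : ℝ, HasDerivAt (fun s : ℝ => s • x + (1 - s) • y) (x - y) s := by
    intro s
    have h1 : HasDerivAt (fun s : ℝ => s • x + (1 - s) • y) ((1 : ℝ) • x + (-1 : ℝ) • y) s :=
      ((hasDerivAt_id s).smul_const x).add (((hasDerivAt_id s).const_sub 1).smul_const y)
    simpa [sub_eq_add_neg] using h1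
  have hder : ∀ s : ℝ, HasDerivAt (fun s : ℝ => u (s • x + (1 - s) • y))
      (fderiv ℝ u (s • x + (1 - s) • y) (x - y)) s := fun s =>
    ((hu.differentiable (by simp) _).hasFDerivAt).comp_hasDerivAt s (hpath s)
  have hcont : Continuous fun s : ℝ => fderiv ℝ u (s • x + (1 - s) • y) (x - y) := by fun_prop
  have hint := intervalIntegral.integral_eq_sub_of_hasDerivAt (a := 0) (b := 1 / 2)
    (fun s _ => hder s) (hcont.intervalIntegrable _ _)
  have he : u y - u ((1 / 2 : ℝ) • x + (1 / 2 : ℝ) • y) =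
      -∫ s in (0 : ℝ)..(1 / 2), fderiv ℝ u (s • x + (1 - s) • y) (x - y) := by
    rw [hint]
    norm_num
  rw [he, enorm_neg, intervalIntegral.integral_of_le (by norm_num),
    ← lintegral_const_mul' _ _ ENNReal.ofReal_ne_top]
  refine (enorm_integral_le_lintegral_enorm _).trans (lintegral_mono fun s => ?_)
  refine (ContinuousLinearMap.le_opENorm _ _).trans ?_
  have hxy : ‖x - y‖ₑ ≤ ENNReal.ofReal r * 2 := by
    rw [← ofReal_norm, show (2 : ℝ≥0∞) = ENNReal.ofReal 2 by norm_num,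
      ← ENNReal.ofReal_mul' (by norm_num)]
    refine ENNReal.ofReal_le_ofReal ?_
    rw [mem_closedBall, dist_eq_norm] at hx hy
    have := norm_sub_le (x - c) (y - c)
    simp only [sub_sub_sub_cancel_right] at this
    linarith
  calc _ ≤ ‖fderiv ℝ u (s • x + (1 - s) • y)‖ₑ * (ENNReal.ofReal r * 2) := by gcongr
    _ = _ := by ring

theorem lintegral_enorm_sub_midpoint_le {u : ℂ → ℂ} (hu : ContDiff ℝ 1 u) {c : ℂ} {r : ℝ} {x : ℂ}
    (hx : x ∈ closedBall c r) :
    ∫⁻ y, ‖u y - u ((1 / 2 : ℝ) • x + (1 / 2 : ℝ) • y)‖ₑ ∂discMeasure c r ≤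
      4 * ENNReal.ofReal r * ∫⁻ z, ‖fderiv ℝ u z‖ₑ ∂discMeasure c r := by
  have hD : Continuous (fderiv ℝ u) := hu.continuous_fderiv (by simp)
  calc ∫⁻ y, ‖u y - u ((1 / 2 : ℝ) • x + (1 / 2 : ℝ) • y)‖ₑ ∂discMeasure c r
      ≤ ∫⁻ y, (ENNReal.ofReal r * ∫⁻ s in Ioc (0 : ℝ) (1 / 2), 2 *
          ‖fderiv ℝ u (s • x + (1 - s) • y)‖ₑ) ∂discMeasure c r :=
        lintegral_mono_ae <| (ae_mem_discMeasure c r).mono fun y hy =>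
          enorm_sub_midpoint_le hu hx hy
    _ = ENNReal.ofReal r * ∫⁻ s in Ioc (0 : ℝ) (1 / 2), 2 * ∫⁻ y in closedBall c r,
          ‖fderiv ℝ u (s • x + (1 - s) • y)‖ₑ := by
        rw [lintegral_const_mul' _ _ ENNReal.ofReal_ne_top, lintegral_lintegral_swap]
        · congr 1
          refine lintegral_congr fun s => ?_
          rw [lintegral_const_mul' _ _ (by norm_num)]
          rfl
        · have : Continuous fun p : ℂ × ℝ => fderiv ℝ u (p.2 • x + (1 - p.2) • p.1) := by fun_prop
          exact (this.enorm.measurable.const_mul 2).aemeasurable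
    _ ≤ ENNReal.ofReal r * ∫⁻ _ in Ioc (0 : ℝ) (1 / 2),
          2 * (4 * ∫⁻ z, ‖fderiv ℝ u z‖ₑ ∂discMeasure c r) := by
        gcongr ENNReal.ofReal r * ?_
        refine setLIntegral_mono' measurableSet_Ioc fun s hs => ?_
        gcongr
        exact lintegral_comp_affine_le hD.enorm.measurable hx hs.1.le hs.2
    _ = 4 * ENNReal.ofReal r * ∫⁻ z, ‖fderiv ℝ u z‖ₑ ∂discMeasure c r := by
        rw [lintegral_const, Measure.restrict_apply_univ, Real.volume_Ioc]
        have : ENNReal.ofReal (1 / 2 - 0) * 2 = 1 := by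
          rw [show (2 : ℝ≥0∞) = ENNReal.ofReal 2 by norm_num,
            ← ENNReal.ofReal_mul' (by norm_num)]
          norm_num
        calc _ = 4 * ENNReal.ofReal r * (∫⁻ z, ‖fderiv ℝ u z‖ₑ ∂discMeasure c r) *
              (ENNReal.ofReal (1 / 2 - 0) * 2) := by ring
          _ = _ := by rw [this, mul_one]

/-- For a smooth function the Poincaré inequality follows by integrating the derivative from
`x` and from `y` to their midpoint: the substitutions involved then have Jacobian at least `1/4`. -/
theorem poincareOn_of_contDiff {u : ℂ → ℂ} (hu : ContDiff ℝ 1 u) (c : ℂ) (r : ℝ) :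
    PoincareOn c r u (fderiv ℝ u) := by
  set ν := discMeasure c r with hν
  set I := ∫⁻ z, ‖fderiv ℝ u z‖ₑ ∂ν with hI
  have hc : Continuous fun p : ℂ × ℂ => u p.2 - u ((1 / 2 : ℝ) • p.1 + (1 / 2 : ℝ) • p.2) := by
    have := hu.continuous
    fun_prop
  have hm := hc.enorm.measurable.aemeasurable (μ := ν.prod ν)
  have key : ∫⁻ p, ‖u p.2 - u ((1 / 2 : ℝ) • p.1 + (1 / 2 : ℝ) • p.2)‖ₑ ∂ν.prod ν ≤
      4 * ENNReal.ofReal r * I * volume (closedBall c r) := by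
    rw [lintegral_prod _ hm, ← discMeasure_univ, ← lintegral_const]
    exact lintegral_mono_ae <| (ae_mem_discMeasure c r).mono fun x hx =>
      lintegral_enorm_sub_midpoint_le hu hx
  have key' : ∫⁻ p, ‖u p.1 - u ((1 / 2 : ℝ) • p.1 + (1 / 2 : ℝ) • p.2)‖ₑ ∂ν.prod ν ≤
      4 * ENNReal.ofReal r * I * volume (closedBall c r) := by
    refine le_trans (le_of_eq ?_) key
    rw [← lintegral_prod_swap]
    refine lintegral_congr fun p => ?_
    simp only [Prod.fst_swap, Prod.snd_swap]
    rw [add_comm]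
  calc ∫⁻ p, ‖u p.1 - u p.2‖ₑ ∂ν.prod ν
      ≤ ∫⁻ p, (‖u p.1 - u ((1 / 2 : ℝ) • p.1 + (1 / 2 : ℝ) • p.2)‖ₑ +
          ‖u p.2 - u ((1 / 2 : ℝ) • p.1 + (1 / 2 : ℝ) • p.2)‖ₑ) ∂ν.prod ν := by
        refine lintegral_mono fun p => ?_
        have := enorm_sub_le (a := u p.1 - u ((1 / 2 : ℝ) • p.1 + (1 / 2 : ℝ) • p.2))
          (b := u p.2 - u ((1 / 2 : ℝ) • p.1 + (1 / 2 : ℝ) • p.2))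
        rwa [sub_sub_sub_cancel_right] at this
    _ ≤ _ := by
        rw [lintegral_add_right' _ hm]
        refine (add_le_add key' key).trans_eq ?_
        ring

/-- The Poincaré inequality on discs for functions with a weak derivative. -/
theorem HasWeakFDeriv.poincareOn {u : ℂ → ℂ} {D : ℂ → ℂ →L[ℝ] ℂ} (h : HasWeakFDeriv u D) (c : ℂ)
    (r : ℝ) : PoincareOn c r u D := by
  have hs : ∀ n, ContDiff ℝ ∞ (mollify n u) := fun n => contDiff_mollify n h.locInt
  refine poincareOn_of_tendsto (F := fun n => mollify n u) (G := fun n => mollify n D)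
    (fun n => ?_) (fun n => (hs n).continuous.aestronglyMeasurable)
    h.locInt'.aestronglyMeasurable (ae_tendsto_mollify h.locInt)
    (tendstoLpLoc_mollify_one h.locInt')
  rw [← h.fderiv_mollify n]
  exact poincareOn_of_contDiff ((hs n).of_le (by simp)) c r

/-- If a sequence tends to `0` almost everywhere and its mean oscillation over a disc tends to `0`,
then it tends to `0` in `L^1` of the disc. -/
theorem tendsto_lintegral_of_tendsto_oscillation {c : ℂ} {r : ℝ} (hr : 0 < r) {h : ℕ → ℂ → ℂ}
    (hm : ∀ n, AEStronglyMeasurable (h n) (discMeasure c r))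
    (hae : ∀ᵐ z ∂discMeasure c r, Tendsto (fun n => h n z) atTop (𝓝 0))
    (hosc : Tendsto (fun n => ∫⁻ p, ‖h n p.1 - h n p.2‖ₑ ∂(discMeasure c r).prod (discMeasure c r))
      atTop (𝓝 0)) :
    Tendsto (fun n => ∫⁻ z, ‖h n z‖ₑ ∂discMeasure c r) atTop (𝓝 0) := by
  set ν := discMeasure c r with hν
  set V := ν univ with hV
  have hV0 : V ≠ 0 := by
    rw [hV, hν, discMeasure_univ]
    exact (measure_closedBall_pos volume c hr).ne'
  have hVtop : V ≠ ⊤ := measure_ne_top ν univ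
  -- `w` is a bounded substitute for `|h n|`, to which dominated convergence applies.
  let w : ℕ → ℂ → ℝ≥0∞ := fun n z => min 1 ‖h n z‖ₑ
  have hwm : ∀ n, AEMeasurable (w n) ν := fun n => aemeasurable_const.min (hm n).enorm
  have hW : Tendsto (fun n => ∫⁻ z, w n z ∂ν) atTop (𝓝 0) := by
    have := tendsto_lintegral_of_dominated_convergence' (μ := ν) (F := w) (f := fun _ => 0)
      (fun _ => 1) hwm (fun n => .of_forall fun z => min_le_left _ _) (by simp) ?_
    · simpa using this
    · filter_upwards [hae] with z hz
      have h1 : Tendsto (fun n => ‖h n z‖ₑ) atTop (𝓝 0) := by simpa using hz.enorm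
      exact tendsto_of_tendsto_of_tendsto_of_le_of_le tendsto_const_nhds h1 (fun _ => zero_le)
        fun n => min_le_right _ _
  have hbound : ∀ n, (∫⁻ z, ‖h n z‖ₑ ∂ν) * (V - ∫⁻ z, w n z ∂ν) ≤
      ∫⁻ p, ‖h n p.1 - h n p.2‖ₑ ∂ν.prod ν + V * ∫⁻ z, w n z ∂ν := by
    intro n
    calc (∫⁻ z, ‖h n z‖ₑ ∂ν) * (V - ∫⁻ z, w n z ∂ν)
        ≤ (∫⁻ z, ‖h n z‖ₑ ∂ν) * ∫⁻ y, (1 - w n y) ∂ν := by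
          gcongr
          have := lintegral_sub_le' (μ := ν) (w n) (fun _ => 1) (hwm n)
          simpa using this
      _ = ∫⁻ p, ‖h n p.1‖ₑ * (1 - w n p.2) ∂ν.prod ν :=
          (lintegral_prod_mul (hm n).enorm (aemeasurable_const.sub (hwm n))).symm
      _ ≤ ∫⁻ p, (‖h n p.1 - h n p.2‖ₑ + w n p.2) ∂ν.prod ν := by
          refine lintegral_mono fun p => ?_
          by_cases h1 : ‖h n p.2‖ₑ ≤ 1
          · have hw : w n p.2 = ‖h n p.2‖ₑ := min_eq_right h1
            calc ‖h n p.1‖ₑ * (1 - w n p.2) ≤ ‖h n p.1‖ₑ * 1 := by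
                  gcongr; exact tsub_le_self
              _ ≤ _ := by
                  rw [mul_one, hw]
                  simpa using enorm_add_le (h n p.1 - h n p.2) (h n p.2)
          · have hw : w n p.2 = 1 := min_eq_left (le_of_not_ge h1)
            simp [hw]
      _ = _ := by
          rw [lintegral_add_right' _ (hwm n).comp_snd]
          congr 1
          have := lintegral_prod_mul (μ := ν) (ν := ν) (f := fun _ => 1) (g := w n)
            aemeasurable_const (hwm n)
          simpa only [one_mul, lintegral_one] using this
  have hden : Tendsto (fun n => V - ∫⁻ z, w n z ∂ν) atTop (𝓝 V) := by
    have := ENNReal.Tendsto.sub (tendsto_const_nhds (x := V)) hW (Or.inl hVtop)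
    simpa using this
  have hnum : Tendsto (fun n => ∫⁻ p, ‖h n p.1 - h n p.2‖ₑ ∂ν.prod ν + V * ∫⁻ z, w n z ∂ν)
      atTop (𝓝 0) := by
    have := hosc.add (ENNReal.Tendsto.const_mul hW (Or.inr hVtop))
    simpa using this
  have hdiv := ENNReal.Tendsto.div hnum (Or.inr hV0) hden (Or.inl hVtop)
  rw [ENNReal.zero_div] at hdiv
  refine tendsto_of_tendsto_of_tendsto_of_le_of_le' tendsto_const_nhds hdiv
    (.of_forall fun _ => zero_le) ?_
  filter_upwards [hden.eventually_ne hV0] with n hn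
  rw [ENNReal.le_div_iff_mul_le (Or.inl hn)
    (Or.inl (ne_top_of_le_ne_top hVtop tsub_le_self))]
  exact hbound n

/-- If `F n → u` almost everywhere and the weak derivatives converge to `D` in `L^1_loc`, then `u`
is locally integrable, with weak derivative `D`. The Poincaré inequality upgrades the convergence
almost everywhere to convergence in `L^1_loc`. -/
theorem hasWeakFDeriv_of_ae_tendsto {F : ℕ → ℂ → ℂ} {G : ℕ → ℂ → ℂ →L[ℝ] ℂ} {u : ℂ → ℂ}
    {D : ℂ → ℂ →L[ℝ] ℂ} (h : ∀ n, HasWeakFDeriv (F n) (G n)) (hu : AEStronglyMeasurable u)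
    (hDm : AEStronglyMeasurable D) (hF : ∀ᵐ z, Tendsto (fun n => F n z) atTop (𝓝 (u z)))
    (hG : TendstoLpLoc 1 G D) : HasWeakFDeriv u D := by
  have hD : LocallyIntegrable D := hG.locallyIntegrable (fun n => (h n).locInt') hDm
  have hFu : TendstoLpLoc 1 F u := by
    intro R
    wlog hR : 0 < R
    · refine tendsto_of_tendsto_of_tendsto_of_le_of_le tendsto_const_nhds (this h hu hDm hF hG hD 1
        one_pos) (fun _ => zero_le) fun n => ?_
      exact eLpNorm_mono_measure _ (Measure.restrict_mono
        (closedBall_subset_closedBall (by linarith)) le_rfl)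
    simp only [eLpNorm_one_eq_lintegral_enorm]
    have hac : discMeasure 0 R ≪ volume := (discMeasure_le 0 R).absolutelyContinuous
    refine tendsto_lintegral_of_tendsto_oscillation hR (h := fun n => F n - u)
      (fun n => ((h n).locInt.aestronglyMeasurable.sub hu).mono_ac hac) ?_ ?_
    · filter_upwards [hac.ae_le hF] with z hz
      simpa using hz.sub_const (u z)
    · -- The Poincaré inequality for `F n - u` is the limit of those for `F n - F m` as `m → ∞`.
      have hP : ∀ n, PoincareOn 0 R (F n - u) (G n - D) := fun n => by
        refine poincareOn_of_tendsto (F := fun m => F n - F m) (G := fun m => G n - G m)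
          (fun m => ((h n).sub (h m)).poincareOn 0 R)
          (fun m => ((h n).sub (h m)).locInt.aestronglyMeasurable)
          ((h n).locInt'.aestronglyMeasurable.sub hDm) ?_ fun R' => ?_
        · filter_upwards [hF] with z hz using hz.const_sub (F n z)
        · refine (hG R').congr fun m => ?_
          change _ = eLpNorm (G n - G m - (G n - D)) 1 _
          rw [sub_sub_sub_cancel_left, ← eLpNorm_neg, neg_sub]
      have h1 := hG R
      simp only [eLpNorm_one_eq_lintegral_enorm] at h1
      have h2 := ENNReal.Tendsto.const_mul (a := 8 * ENNReal.ofReal R * volume (closedBall (0 : ℂ) R))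
        h1 (Or.inr (ENNReal.mul_ne_top (ENNReal.mul_ne_top (by norm_num) ENNReal.ofReal_ne_top)
          (isCompact_closedBall _ _).measure_lt_top.ne))
      rw [mul_zero] at h2
      exact tendsto_of_tendsto_of_tendsto_of_le_of_le tendsto_const_nhds h2 (fun _ => zero_le) hP
  have hul : LocallyIntegrable u := hFu.locallyIntegrable (fun n => (h n).locInt) hu
  exact hasWeakFDeriv_of_tendstoLpLoc h hul hD hFu hG

/-! ### The chain rule for smooth outer functions -/

theorem enorm_comp_sub_comp_le (A B P Q : ℂ →L[ℝ] ℂ) :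
    ‖A.comp P - B.comp Q‖ₑ ≤ ‖A‖ₑ * ‖P - Q‖ₑ + ‖A - B‖ₑ * ‖Q‖ₑ := by
  have h : A.comp P - B.comp Q = A.comp (P - Q) + (A - B).comp Q := by
    rw [ContinuousLinearMap.comp_sub, ContinuousLinearMap.sub_comp]
    abel
  rw [h]
  exact (enorm_add_le (A.comp (P - Q)) ((A - B).comp Q)).trans
    (add_le_add (A.opENorm_comp_le _) ((A - B).opENorm_comp_le _))

/-- The chain rule for a `C^1` function after a continuous function with a weak derivative. -/
theorem HasWeakFDeriv.contDiff_comp {f : ℂ → ℂ} {D : ℂ → ℂ →L[ℝ] ℂ} (hf : HasWeakFDeriv f D)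
    (hfc : Continuous f) {g : ℂ → ℂ} (hg : ContDiff ℝ 1 g) :
    HasWeakFDeriv (g ∘ f) fun z => (fderiv ℝ g (f z)).comp (D z) := by
  have hgD : Continuous (fderiv ℝ g) := hg.continuous_fderiv (by simp)
  have hs : ∀ n, ContDiff ℝ 1 (mollify n f) := fun n =>
    (contDiff_mollify n hf.locInt).of_le (by simp)
  have hcompc : Continuous fun p : (ℂ →L[ℝ] ℂ) × (ℂ →L[ℝ] ℂ) => p.1.comp p.2 := by fun_prop
  have hGm : ∀ n, Continuous (mollify n D) := fun n => (contDiff_mollify n hf.locInt').continuous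
  have hDm := hf.locInt'.aestronglyMeasurable
  refine hasWeakFDeriv_of_ae_tendsto (F := fun n => g ∘ mollify n f)
    (G := fun n z => (fderiv ℝ g (mollify n f z)).comp (mollify n D z)) (fun n => ?_)
    (hg.continuous.comp hfc).aestronglyMeasurable
    (hcompc.comp_aestronglyMeasurable (f := fun z => (fderiv ℝ g (f z), D z))
      ((hgD.comp hfc).aestronglyMeasurable.prodMk hDm))
    (.of_forall fun z => (hg.continuous.tendsto _).comp (tendsto_mollify hfc z)) fun R => ?_
  · convert hasWeakFDeriv_of_contDiff (hg.comp (hs n)) using 2 with z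
    rw [fderiv_comp z (hg.differentiable (by simp) _) ((hs n).differentiable (by simp) _),
      hf.fderiv_mollify n]
  · obtain ⟨C, hC⟩ := exists_norm_mollify_le hfc R
    obtain ⟨M, hM⟩ := (isCompact_closedBall (0 : ℂ) C).exists_bound_of_continuousOn
      hgD.continuousOn
    have hM1 : ∀ n, ∀ z ∈ closedBall (0 : ℂ) R, ‖fderiv ℝ g (mollify n f z)‖ₑ ≤ ENNReal.ofReal M := by
      intro n z hz
      rw [← ofReal_norm]
      exact ENNReal.ofReal_le_ofReal (hM _ (mem_closedBall_zero_iff.2 (hC n z hz)))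
    have hM2 : ∀ z ∈ closedBall (0 : ℂ) R, ‖fderiv ℝ g (f z)‖ₑ ≤ ENNReal.ofReal M := fun z hz =>
      le_of_tendsto (((hgD.tendsto _).comp (tendsto_mollify hfc z)).enorm)
        (.of_forall fun n => hM1 n z hz)
    have hB : MeasurableSet (closedBall (0 : ℂ) R) := isClosed_closedBall.measurableSet
    have l1 : Tendsto (fun n => ENNReal.ofReal M *
        eLpNorm (mollify n D - D) 1 (volume.restrict (closedBall 0 R))) atTop (𝓝 0) := by
      have := ENNReal.Tendsto.const_mul (a := ENNReal.ofReal M)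
        (tendstoLpLoc_mollify_one hf.locInt' R) (Or.inr ENNReal.ofReal_ne_top)
      rwa [mul_zero] at this
    have l2 : Tendsto (fun n => ∫⁻ z in closedBall 0 R,
        ‖fderiv ℝ g (mollify n f z) - fderiv ℝ g (f z)‖ₑ * ‖D z‖ₑ) atTop (𝓝 0) := by
      have := tendsto_lintegral_of_dominated_convergence' (μ := volume.restrict (closedBall 0 R))
        (F := fun n z => ‖fderiv ℝ g (mollify n f z) - fderiv ℝ g (f z)‖ₑ * ‖D z‖ₑ)
        (f := fun _ => 0) (fun z => 2 * ENNReal.ofReal M * ‖D z‖ₑ) (fun n => ?_) (fun n => ?_) ?_ ?_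
      · simpa using this
      · exact (((hgD.comp (hs n).continuous).sub
          (hgD.comp hfc)).enorm.measurable.aemeasurable).mul hDm.restrict.enorm
      · filter_upwards [ae_restrict_mem hB] with z hz
        gcongr
        refine (enorm_sub_le).trans ((add_le_add (hM1 n z hz) (hM2 z hz)).trans_eq ?_)
        ring
      · rw [lintegral_const_mul' _ _ (by finiteness)]
        refine ENNReal.mul_ne_top (by finiteness) ?_
        exact (locallyIntegrable_iff_closedBall.1 hf.locInt' R).2.ne
      · refine .of_forall fun z => ?_
        have h1 : Tendsto (fun n => ‖fderiv ℝ g (mollify n f z) - fderiv ℝ g (f z)‖ₑ) atTop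
            (𝓝 0) := by
          have := (((hgD.tendsto _).comp (tendsto_mollify hfc z)).sub_const
            (fderiv ℝ g (f z))).enorm
          simpa using this
        have := ENNReal.Tendsto.mul_const h1 (Or.inr (enorm_ne_top (x := D z)))
        rwa [zero_mul] at this
    have l3 := l1.add l2
    rw [add_zero] at l3
    refine tendsto_of_tendsto_of_tendsto_of_le_of_le tendsto_const_nhds l3 (fun _ => zero_le)
      fun n => ?_
    simp only [eLpNorm_one_eq_lintegral_enorm]
    rw [← lintegral_const_mul' _ _ ENNReal.ofReal_ne_top, ← lintegral_add_left'
      (((((hGm n).aestronglyMeasurable).sub hDm.restrict).enorm).const_mul _)]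
    refine setLIntegral_mono' hB fun z hz => ?_
    simp only [Pi.sub_apply]
    refine (enorm_comp_sub_comp_le _ _ _ _).trans ?_
    gcongr
    exact hM1 n z hz

/-! ### The area inequality -/

theorem volume_closedBall_half (a c : ℂ) (r : ℝ) :
    volume (closedBall c r) = 4 * volume (closedBall a (r / 2)) := by
  rw [Complex.volume_closedBall, Complex.volume_closedBall, ENNReal.ofReal_div_of_pos (by norm_num),
    ENNReal.div_eq_inv_mul, mul_pow, ← mul_assoc, ← mul_assoc]
  congr 2
  rw [show ENNReal.ofReal 2 = 2 by norm_num, ← ENNReal.inv_pow, show (2 : ℝ≥0∞) ^ 2 = 4 by norm_num,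
    ENNReal.mul_inv_cancel (by norm_num) (by norm_num), one_mul]

theorem _root_.MeasureTheory.LocallyIntegrable.integrable_discMeasure {E : Type*}
    [NormedAddCommGroup E] {u : ℂ → E} (hu : LocallyIntegrable u) (c : ℂ) (r : ℝ) :
    Integrable u (discMeasure c r) :=
  hu.integrableOn_isCompact (isCompact_closedBall c r)

theorem _root_.Continuous.integrable_discMeasure {u : ℂ → ℂ} (hu : Continuous u) (c : ℂ) (r : ℝ) :
    Integrable u (discMeasure c r) :=
  hu.locallyIntegrable.integrable_discMeasure c r

/-- Averages over a disc and over a disc of half the radius inside it are close, by the Poincaré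
inequality. -/
theorem norm_average_sub_average_le {u : ℂ → ℂ} {D : ℂ → ℂ →L[ℝ] ℂ} (h : HasWeakFDeriv u D)
    (hu : Continuous u) {a c : ℂ} {r : ℝ} (hr : 0 < r)
    (hsub : closedBall a (r / 2) ⊆ closedBall c r) {δ : ℝ≥0}
    (hδ : ∫⁻ z, ‖D z‖ₑ ∂discMeasure c r ≤ δ * volume (closedBall c r)) :
    ‖(⨍ z, u z ∂discMeasure a (r / 2)) - ⨍ z, u z ∂discMeasure c r‖ ≤ 32 * r * δ := by
  set μ := discMeasure a (r / 2)
  set ν := discMeasure c r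
  have hμ : μ univ = volume (closedBall a (r / 2)) := discMeasure_univ _ _
  have hν : ν univ = volume (closedBall c r) := discMeasure_univ _ _
  have hμν : ν univ = 4 * μ univ := by rw [hμ, hν, volume_closedBall_half a c r]
  have hμ0 : μ univ ≠ 0 := by
    rw [hμ]; exact (measure_closedBall_pos volume a (by positivity)).ne'
  have hμt : μ univ ≠ ⊤ := measure_ne_top _ _
  have hν0 : ν univ ≠ 0 := by
    rw [hν]; exact (measure_closedBall_pos volume c hr).ne'
  have hνt : ν univ ≠ ⊤ := measure_ne_top _ _
  have iu := hu.integrable_discMeasure a (r / 2)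
  have iv := hu.integrable_discMeasure c r
  have hint : ∫ p, (u p.1 - u p.2) ∂μ.prod ν =
      (μ.real univ * ν.real univ) • ((⨍ z, u z ∂μ) - ⨍ z, u z ∂ν) := by
    rw [integral_sub (iu.comp_fst ν) (iv.comp_snd μ), integral_fun_fst, integral_fun_snd, smul_sub,
      mul_smul, mul_smul, measure_smul_average, smul_comm (μ.real univ), measure_smul_average]
  have hle : ‖∫ p, (u p.1 - u p.2) ∂μ.prod ν‖ₑ ≤
      8 * ENNReal.ofReal r * ν univ * (δ * ν univ) := by
    refine (enorm_integral_le_lintegral_enorm _).trans ?_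
    refine (lintegral_mono' (Measure.prod_mono (Measure.restrict_mono hsub le_rfl) le_rfl)
      le_rfl).trans ?_
    refine (h.poincareOn c r).trans ?_
    rw [hν]
    gcongr
  rw [hint, enorm_smul, Real.enorm_of_nonneg (by positivity), ENNReal.ofReal_mul (by positivity),
    Measure.real, Measure.real, ENNReal.ofReal_toReal hμt, ENNReal.ofReal_toReal hνt] at hle
  have hle2 : (μ univ * ν univ) * ‖(⨍ z, u z ∂μ) - ⨍ z, u z ∂ν‖ₑ ≤
      (μ univ * ν univ) * ENNReal.ofReal (32 * r * δ) := by
    refine hle.trans_eq ?_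
    rw [ENNReal.ofReal_mul (by positivity), ENNReal.ofReal_mul (by norm_num),
      ENNReal.ofReal_coe_nnreal, show ENNReal.ofReal 32 = 8 * 4 by norm_num]
    nth_rw 2 [hμν]
    ring
  rw [ENNReal.mul_le_mul_iff_right (mul_ne_zero hμ0 hν0) (ENNReal.mul_ne_top hμt hνt),
    ← ofReal_norm] at hle2
  exact (ENNReal.ofReal_le_ofReal_iff (by positivity)).1 hle2

/-- Averages of a continuous function over shrinking discs converge to its value at the centre. -/
theorem tendsto_average_discMeasure {u : ℂ → ℂ} (hu : Continuous u) (x : ℂ) {ρ : ℕ → ℝ}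
    (hρ : ∀ n, 0 < ρ n) (hlim : Tendsto ρ atTop (𝓝 0)) :
    Tendsto (fun n => ⨍ z, u z ∂discMeasure x (ρ n)) atTop (𝓝 (u x)) := by
  rw [Metric.tendsto_nhds]
  intro ε hε
  obtain ⟨s, hs, hball⟩ := Metric.eventually_nhds_iff_ball.1
    (Metric.tendsto_nhds.1 (hu.tendsto x) (ε / 2) (half_pos hε))
  filter_upwards [hlim.eventually (gt_mem_nhds hs)] with n hn
  have hne : NeZero (discMeasure x (ρ n)) := ⟨fun h0 => by
    have h1 := discMeasure_univ x (ρ n)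
    rw [h0] at h1
    exact (measure_closedBall_pos volume x (hρ n)).ne h1⟩
  have hmem : (⨍ z, u z ∂discMeasure x (ρ n)) ∈ closedBall (u x) (ε / 2) := by
    refine (convex_closedBall _ _).average_mem isClosed_closedBall ?_
      (hu.integrable_discMeasure _ _)
    filter_upwards [ae_mem_discMeasure x (ρ n)] with z hz
    exact (hball z (closedBall_subset_ball hn hz)).le
  exact (mem_closedBall.1 hmem).trans_lt (half_lt_self hε)

/-- The points at which the mean of `|D - A|` over every disc of radius at most `R` is at most
`δ`. -/
def smallMeanSet (D : ℂ → ℂ →L[ℝ] ℂ) (A : ℂ →L[ℝ] ℂ) (δ : ℝ≥0) (R : ℝ) : Set ℂ :=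
  {x | ∀ ρ, 0 < ρ → ρ ≤ R → ∫⁻ z, ‖D z - A‖ₑ ∂discMeasure x ρ ≤ δ * volume (closedBall x ρ)}

/-- Comparison of the value at a point with the average over a disc: the averages over the discs
with radii `r / 2 ^ k` form a geometrically convergent sequence. -/
theorem norm_average_sub_le {u : ℂ → ℂ} {D : ℂ → ℂ →L[ℝ] ℂ} (h : HasWeakFDeriv u D)
    (hu : Continuous u) {x : ℂ} {r : ℝ} (hr : 0 < r) {δ : ℝ≥0}
    (hx : x ∈ smallMeanSet D 0 δ r) :
    dist (⨍ z, u z ∂discMeasure x r) (u x) ≤ 64 * r * δ := by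
  have hpos : ∀ k : ℕ, 0 < r / 2 ^ k := fun k => by positivity
  have hlim : Tendsto (fun k : ℕ => r / 2 ^ k) atTop (𝓝 0) :=
    tendsto_const_nhds.div_atTop (tendsto_pow_atTop_atTop_of_one_lt one_lt_two)
  have := dist_le_of_le_geometric_two_of_tendsto₀ (C := 64 * r * δ)
    (f := fun k : ℕ => ⨍ z, u z ∂discMeasure x (r / 2 ^ k)) (a := u x) (fun k => ?_)
    (tendsto_average_discMeasure hu x hpos hlim)
  · simpa using this
  · have hle : r / 2 ^ k ≤ r := div_le_self hr.le (one_le_pow₀ one_le_two)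
    have h1 := norm_average_sub_average_le h hu (hpos k) (a := x) (c := x)
      (closedBall_subset_closedBall (half_le_self (hpos k).le)) (δ := δ)
      (by simpa using hx _ (hpos k) hle)
    rw [dist_comm, dist_eq_norm, pow_succ, ← div_div]
    refine h1.trans_eq ?_
    ring

/-- A continuous function is Lipschitz where the means of its weak derivative over small discs are
bounded. -/
theorem dist_le_of_mem_smallMeanSet {u : ℂ → ℂ} {D : ℂ → ℂ →L[ℝ] ℂ} (h : HasWeakFDeriv u D)
    (hu : Continuous u) {x y : ℂ} {R : ℝ} {δ : ℝ≥0} (hx : x ∈ smallMeanSet D 0 δ R)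
    (hy : y ∈ smallMeanSet D 0 δ R) (hxy : 2 * dist x y ≤ R) :
    dist (u x) (u y) ≤ 256 * δ * dist x y := by
  rcases eq_or_ne x y with rfl | hne
  · simp
  set r := dist x y with hr
  have hr0 : 0 < r := dist_pos.2 hne
  have h1 := norm_average_sub_le h hu (x := x) (r := 2 * r) (by positivity) (δ := δ)
    fun ρ h0 h1 => hx ρ h0 (h1.trans hxy)
  have h2 := norm_average_sub_le h hu (x := y) (r := r) hr0 (δ := δ)
    fun ρ h0 h1 => hy ρ h0 (by linarith)
  have h3 := norm_average_sub_average_le h hu (r := 2 * r) (a := y) (c := x) (by positivity)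
    (closedBall_subset_closedBall' (by rw [dist_comm, ← hr]; linarith)) (δ := δ)
    (by simpa using hx (2 * r) (by positivity) hxy)
  rw [← dist_eq_norm, show 2 * r / 2 = r by ring] at h3
  have t1 := dist_triangle_left (u x) (u y) (⨍ z, u z ∂discMeasure x (2 * r))
  have t2 := dist_triangle_left (⨍ z, u z ∂discMeasure x (2 * r)) (u y)
    (⨍ z, u z ∂discMeasure y r)
  nlinarith

/-- Where the means of `|D - A|` are small, `f` is close to the linear map `A`. -/
theorem approximatesLinearOn_smallMeanSet {f : ℂ → ℂ} {D : ℂ → ℂ →L[ℝ] ℂ} (h : HasWeakFDeriv f D)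
    (hf : Continuous f) (A : ℂ →L[ℝ] ℂ) (δ : ℝ≥0) {R : ℝ} (p : ℂ) :
    ApproximatesLinearOn f A (closure (smallMeanSet D A δ R ∩ closedBall p (R / 4))) (256 * δ) := by
  set s := smallMeanSet D A δ R ∩ closedBall p (R / 4)
  have hA : HasWeakFDeriv (f - A) (D - fun _ => A) := by
    refine h.sub ?_
    have := hasWeakFDeriv_of_contDiff (u := A) A.contDiff
    convert this using 2 with z
    exact A.fderiv.symm
  have hset : ∀ q, q ∈ smallMeanSet D A δ R → q ∈ smallMeanSet (D - fun _ => A) 0 δ R := by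
    intro q hq ρ h0 h1
    simpa using hq ρ h0 h1
  have hclosed : IsClosed {q : ℂ × ℂ | ‖f q.1 - f q.2 - A (q.1 - q.2)‖ ≤
      (256 * δ : ℝ≥0) * ‖q.1 - q.2‖} := by
    refine isClosed_le ?_ ?_ <;> fun_prop
  have hsub : s ×ˢ s ⊆ {q : ℂ × ℂ | ‖f q.1 - f q.2 - A (q.1 - q.2)‖ ≤
      (256 * δ : ℝ≥0) * ‖q.1 - q.2‖} := by
    rintro ⟨x, y⟩ ⟨hx, hy⟩
    have hd : 2 * dist x y ≤ R := by
      have := dist_triangle_right x y p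
      have h1 := mem_closedBall.1 hx.2
      have h2 := mem_closedBall.1 hy.2
      linarith
    have := dist_le_of_mem_smallMeanSet hA (hf.sub A.continuous) (hset x hx.1) (hset y hy.1) hd
    rw [dist_eq_norm, dist_eq_norm] at this
    simp only [mem_ofPred_eq, map_sub]
    refine le_trans (le_of_eq ?_) this
    congr 1
    simp only [Pi.sub_apply]
    ring
  intro x hx y hy
  have : (x, y) ∈ closure (s ×ˢ s) := by
    rw [closure_prod_eq]; exact ⟨hx, hy⟩
  exact hclosed.closure_subset_iff.2 hsub this

/-- By the Lebesgue differentiation theorem, almost every point lies in the sets `smallMeanSet`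
of the linear maps close to the derivative. -/
theorem ae_mem_smallMeanSet {D : ℂ → ℂ →L[ℝ] ℂ} (hD : LocallyIntegrable D) :
    ∀ᵐ x, ∀ (A : ℂ →L[ℝ] ℂ) (δ : ℝ≥0), ‖D x - A‖ < δ →
      ∃ k : ℕ, x ∈ smallMeanSet D A δ (1 / (k + 1)) := by
  filter_upwards [IsUnifLocDoublingMeasure.ae_tendsto_average_norm_sub volume hD 1] with x hx A δ hA
  have hlim := hx (l := 𝓝[>] (0 : ℝ)) (fun _ => x) id tendsto_id (by
    filter_upwards [self_mem_nhdsWithin] with ρ hρ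
    simpa using le_of_lt hρ)
  have hev := hlim.eventually (gt_mem_nhds (sub_pos.2 hA))
  obtain ⟨R, hR, hRs⟩ := (mem_nhdsGT_iff_exists_Ioc_subset).1 hev
  obtain ⟨k, hk⟩ := exists_nat_one_div_lt (show (0 : ℝ) < R from hR)
  refine ⟨k, fun ρ h0 h1 => ?_⟩
  have hρ : ⨍ y in closedBall x ρ, ‖D y - D x‖ < δ - ‖D x - A‖ := hRs ⟨h0, h1.trans hk.le⟩
  have hi : Integrable (fun y => D y - D x) (discMeasure x ρ) :=
    (hD.integrable_discMeasure x ρ).sub (integrable_const _)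
  have i2 : Integrable (fun y => D y - A) (discMeasure x ρ) :=
    (hD.integrable_discMeasure x ρ).sub (integrable_const _)
  set V := (discMeasure x ρ).real univ with hV
  have hint : ∫ y, ‖D y - D x‖ ∂discMeasure x ρ ≤ V * (δ - ‖D x - A‖) := by
    have := measure_smul_average (discMeasure x ρ) fun y => ‖D y - D x‖
    rw [← this, smul_eq_mul]
    exact mul_le_mul_of_nonneg_left hρ.le (by positivity)
  have hint2 : ∫ y, ‖D y - A‖ ∂discMeasure x ρ ≤ V * δ := by
    calc ∫ y, ‖D y - A‖ ∂discMeasure x ρ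
        ≤ ∫ y, (‖D y - D x‖ + ‖D x - A‖) ∂discMeasure x ρ := by
          refine integral_mono i2.norm (hi.norm.add (integrable_const _)) fun y => ?_
          exact norm_sub_le_norm_sub_add_norm_sub _ _ _
      _ = ∫ y, ‖D y - D x‖ ∂discMeasure x ρ + V * ‖D x - A‖ := by
          rw [integral_add hi.norm (integrable_const _), integral_const, smul_eq_mul]
      _ ≤ V * δ := by linarith
  rw [← ofReal_integral_norm_eq_lintegral_enorm i2]
  refine (ENNReal.ofReal_le_ofReal hint2).trans_eq ?_
  rw [ENNReal.ofReal_mul (by positivity), ENNReal.ofReal_coe_nnreal, hV, Measure.real,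
    ENNReal.ofReal_toReal (measure_ne_top _ _), discMeasure_univ, mul_comm]

/-- Near a linear map `A` the determinant varies little, and maps close to `A` expand measure
almost by the factor `|A.det|`. -/
theorem exists_det_close_and_le_image (A : ℂ →L[ℝ] ℂ) {ε : ℝ≥0} (εpos : 0 < ε) :
    ∃ δ : ℝ≥0, 0 < δ ∧ (∀ B : ℂ →L[ℝ] ℂ, ‖B - A‖ ≤ δ → |B.det - A.det| ≤ ε) ∧
      ∀ (t : Set ℂ) (g : ℂ → ℂ), ApproximatesLinearOn g A t (256 * δ) →
        ENNReal.ofReal |A.det| * volume t ≤ volume (g '' t) + ε * volume t := by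
  obtain ⟨δ', δ'pos, hδ'⟩ : ∃ δ' : ℝ, 0 < δ' ∧
      ∀ B : ℂ →L[ℝ] ℂ, dist B A < δ' → dist B.det A.det < ε :=
    continuousAt_iff.1 ContinuousLinearMap.continuous_det.continuousAt ε εpos
  let δ₁ : ℝ≥0 := ⟨δ' / 2, (half_pos δ'pos).le⟩
  have hδ₁ : 0 < δ₁ := half_pos δ'pos
  have hdet : ∀ B : ℂ →L[ℝ] ℂ, ‖B - A‖ ≤ δ₁ → |B.det - A.det| ≤ ε := by
    intro B hB
    rw [← Real.dist_eq]
    refine (hδ' B ?_).le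
    rw [dist_eq_norm]
    exact hB.trans_lt (half_lt_self δ'pos)
  rcases eq_or_ne A.det 0 with hA | hA
  · exact ⟨δ₁, hδ₁, hdet, fun t g _ => by simp [hA]⟩
  have hlt : ((Real.toNNReal |A.det| - ε : ℝ≥0) : ℝ≥0∞) < ENNReal.ofReal |A.det| := by
    rw [ENNReal.ofReal, ENNReal.coe_sub]
    refine ENNReal.sub_lt_self ENNReal.coe_ne_top ?_ ?_
    · simpa only [abs_nonpos_iff, Real.toNNReal_eq_zero, ENNReal.coe_eq_zero, Ne] using hA
    · simpa using εpos.ne'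
  obtain ⟨δ₂, h₂, δ₂pos⟩ :=
    ((mul_le_addHaar_image_of_lt_det volume A hlt).and self_mem_nhdsWithin).exists
  have hδ₂ : 0 < δ₂ / 256 := div_pos δ₂pos (by norm_num)
  refine ⟨min δ₁ (δ₂ / 256), lt_min hδ₁ hδ₂, fun B hB => hdet B (hB.trans ?_), fun t g htg => ?_⟩
  · exact_mod_cast min_le_left _ _
  · rcases eq_or_ne (volume t) ⊤ with ht | ht
    · simp [ht, εpos.ne']
    · have := h₂ t g (htg.mono_num (by
        calc 256 * min δ₁ (δ₂ / 256) ≤ 256 * (δ₂ / 256) := by gcongr; exact min_le_right _ _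
          _ = δ₂ := mul_div_cancel₀ _ (by norm_num)))
      rwa [ENNReal.coe_sub, ENNReal.sub_mul fun _ _ => ht, tsub_le_iff_right] at this

/-- An inequality between measures can be checked on the members of a countable cover. -/
theorem measure_le_of_le_on_cover {α : Type*} [MeasurableSpace α] {μ ν : Measure α} {ι : Type*}
    [Countable ι] {t : ι → Set α} (ht : ∀ i, MeasurableSet (t i)) (hcover : ∀ᵐ x ∂μ, ∃ i, x ∈ t i)
    (h : ∀ i, ∀ s ⊆ t i, MeasurableSet s → μ s ≤ ν s) : μ ≤ ν := by
  rcases isEmpty_or_nonempty ι with hι | hι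
  · have : μ = 0 := by
      rw [← Measure.measure_univ_eq_zero]
      simpa using hcover
    rw [this]; exact Measure.zero_le _
  obtain ⟨e, he⟩ := exists_surjective_nat ι
  refine Measure.le_intro fun s hs _ => ?_
  set T := disjointed fun n => t (e n) with hT
  have hTm : ∀ n, MeasurableSet (T n) := fun n => MeasurableSet.disjointed (fun n => ht (e n)) n
  have hTd : Pairwise (Function.onFun Disjoint fun n => s ∩ T n) :=
    pairwise_disjoint_mono (disjoint_disjointed _) fun n => inter_subset_right
  have hU : ∀ᵐ x ∂μ, x ∈ ⋃ n, T n := by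
    filter_upwards [hcover] with x ⟨i, hi⟩
    obtain ⟨n, rfl⟩ := he i
    rw [hT, iUnion_disjointed]
    exact mem_iUnion.2 ⟨n, hi⟩
  calc μ s = μ (⋃ n, s ∩ T n) := by
        rw [← inter_iUnion]
        refine measure_congr ?_
        filter_upwards [hU] with x hx
        exact propext ⟨fun h => ⟨h, hx⟩, fun h => h.1⟩
    _ = ∑' n, μ (s ∩ T n) := measure_iUnion hTd fun n => hs.inter (hTm n)
    _ ≤ ∑' n, ν (s ∩ T n) := ENNReal.tsum_le_tsum fun n =>
        h (e n) _ (inter_subset_right.trans (disjointed_subset _ _)) (hs.inter (hTm n))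
    _ = ν (⋃ n, s ∩ T n) := (measure_iUnion hTd fun n => hs.inter (hTm n)).symm
    _ ≤ ν s := measure_mono (iUnion_subset fun n => inter_subset_left)

/-- The area inequality up to an error `2 ε`, by covering almost all of the plane with countably
many sets on which `f` is close to a linear map `A` and `D` is close to `A`. -/
theorem withDensity_det_le_add {f : ℂ → ℂ} {D : ℂ → ℂ →L[ℝ] ℂ} (h : HasWeakFDeriv f D)
    (hD : Measurable D) (hf : Topology.IsOpenEmbedding f) {ε : ℝ≥0} (εpos : 0 < ε) :
    volume.withDensity (fun z => ENNReal.ofReal |(D z).det|) ≤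
      volume.comap f + (2 * ε) • volume := by
  have hfe := hf.measurableEmbedding
  choose δ δpos hdet himage using fun A : ℂ →L[ℝ] ℂ => exists_det_close_and_le_image A εpos
  -- Countably many of the balls around `A` with radius `δ A` cover the space of linear maps.
  obtain ⟨T, hTc, hT⟩ := TopologicalSpace.isOpen_iUnion_countable
    (fun A : ℂ →L[ℝ] ℂ => ball A (δ A)) fun A => isOpen_ball
  have : Countable T := hTc.to_subtype
  have hTcover : ∀ B : ℂ →L[ℝ] ℂ, ∃ A ∈ T, ‖B - A‖ < δ A := by
    intro B
    have : B ∈ ⋃ A, ball A (δ A : ℝ) := mem_iUnion.2 ⟨B, mem_ball_self (δpos B)⟩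
    rw [← hT] at this
    simpa only [mem_iUnion, exists_prop, mem_ball, dist_eq_norm] using this
  -- Taking closures makes the sets measurable, and the approximation by `A` persists on the closure
  -- because `f` is continuous.
  let S : T × ℕ × ℕ → Set ℂ := fun i =>
    closure (smallMeanSet D i.1 (δ i.1) (1 / (i.2.1 + 1)) ∩
      closedBall (TopologicalSpace.denseSeq ℂ i.2.2) (1 / (i.2.1 + 1) / 4)) ∩
      {x | ‖D x - i.1‖ ≤ δ i.1}
  have hSm : ∀ i, MeasurableSet (S i) := fun i =>
    isClosed_closure.measurableSet.inter
      (measurableSet_le (hD.sub_const _).norm measurable_const)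
  refine measure_le_of_le_on_cover hSm ?_ ?_
  · refine (withDensity_absolutelyContinuous _ _).ae_le ?_
    filter_upwards [ae_mem_smallMeanSet h.locInt'] with x hx
    obtain ⟨A, hAT, hA⟩ := hTcover (D x)
    obtain ⟨k, hk⟩ := hx A (δ A) hA
    obtain ⟨m, hm⟩ := (TopologicalSpace.denseRange_denseSeq ℂ).exists_dist_lt x
      (show (0 : ℝ) < 1 / (k + 1) / 4 by positivity)
    exact ⟨⟨⟨A, hAT⟩, k, m⟩, subset_closure ⟨hk, hm.le⟩, hA.le⟩
  · intro i s hs hsm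
    set A : ℂ →L[ℝ] ℂ := i.1.1
    have happ : ApproximatesLinearOn f A s (256 * δ A) :=
      (approximatesLinearOn_smallMeanSet h hf.continuous A (δ A) _).mono_set
        (hs.trans inter_subset_left)
    rw [withDensity_apply _ hsm, Measure.add_apply, hfe.comap_apply]
    calc ∫⁻ z in s, ENNReal.ofReal |(D z).det|
        ≤ ∫⁻ _ in s, (ENNReal.ofReal |A.det| + ε) := by
          refine setLIntegral_mono' hsm fun z hz => ?_
          rw [← ENNReal.ofReal_coe_nnreal, ← ENNReal.ofReal_add (abs_nonneg _) ε.coe_nonneg]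
          refine ENNReal.ofReal_le_ofReal ?_
          have h1 := hdet A (D z) (hs hz).2
          have h2 := abs_sub_abs_le_abs_sub (D z).det A.det
          linarith
      _ = ENNReal.ofReal |A.det| * volume s + ε * volume s := by
          rw [setLIntegral_const, add_mul]
      _ ≤ volume (f '' s) + ε * volume s + ε * volume s := by
          gcongr
          exact himage A s f happ
      _ = volume (f '' s) + ((2 * ε) • volume : Measure ℂ) s := by
          rw [Measure.smul_apply, ENNReal.smul_def, smul_eq_mul, ENNReal.coe_mul, add_assoc,
            ← two_mul, mul_assoc]
          rfl

/-- The area inequality: for a topological embedding `f` with weak derivative `D`, the integral of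
`|det D|` over a set is at most the area of the image. -/
theorem withDensity_det_le_comap {f : ℂ → ℂ} {D : ℂ → ℂ →L[ℝ] ℂ} (h : HasWeakFDeriv f D)
    (hf : Topology.IsOpenEmbedding f) :
    volume.withDensity (fun z => ENNReal.ofReal |(D z).det|) ≤ volume.comap f := by
  have hfe := hf.measurableEmbedding
  -- Replace `D` by a measurable representative.
  set D' := h.locInt'.aestronglyMeasurable.mk D
  have hDD' : D =ᵐ[volume] D' := h.locInt'.aestronglyMeasurable.ae_eq_mk
  have hD'm : Measurable D' :=
    h.locInt'.aestronglyMeasurable.stronglyMeasurable_mk.measurable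
  have h' : HasWeakFDeriv f D' := by
    refine ⟨h.locInt, h.locInt'.congr hDD', fun v η hη hc => ?_⟩
    rw [h.integral_eq v η hη hc]
    congr 1
    refine integral_congr_ae ?_
    filter_upwards [hDD'] with z hz
    rw [hz]
  have hcongr : volume.withDensity (fun z => ENNReal.ofReal |(D z).det|) =
      volume.withDensity (fun z => ENNReal.ofReal |(D' z).det|) := by
    refine withDensity_congr_ae ?_
    filter_upwards [hDD'] with z hz
    rw [hz]
  rw [hcongr]
  refine measure_le_of_le_on_cover (t := fun n : ℕ => closedBall (0 : ℂ) n)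
    (fun n => isClosed_closedBall.measurableSet) ?_ fun n s hs hsm => ?_
  · refine .of_forall fun x => ?_
    obtain ⟨n, hn⟩ := exists_nat_ge ‖x‖
    exact ⟨n, mem_closedBall_zero_iff.2 hn⟩
  · have hfin : volume s ≠ ⊤ :=
      ((measure_mono hs).trans_lt (isCompact_closedBall (0 : ℂ) n).measure_lt_top).ne
    have hlim : Tendsto (fun ε : ℝ≥0 => volume.comap f s + 2 * ε * volume s) (𝓝[>] 0)
        (𝓝 (volume.comap f s + 2 * (0 : ℝ≥0) * volume s)) := by
      refine Tendsto.mono_left ?_ nhdsWithin_le_nhds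
      refine tendsto_const_nhds.add (ENNReal.Tendsto.mul_const ?_ (Or.inr hfin))
      exact ENNReal.Tendsto.const_mul (ENNReal.tendsto_coe.2 tendsto_id)
        (Or.inr ENNReal.ofNat_ne_top)
    simp only [add_zero, zero_mul, mul_zero, ENNReal.coe_zero] at hlim
    refine ge_of_tendsto hlim ?_
    filter_upwards [self_mem_nhdsWithin] with ε hε
    refine (withDensity_det_le_add h' hD'm hf hε s).trans_eq ?_
    rw [Measure.add_apply, Measure.smul_apply, ENNReal.smul_def, smul_eq_mul, ENNReal.coe_mul]
    rfl

/-! ### Composition with Sobolev functions -/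

theorem aemeasurable_det {D : ℂ → ℂ →L[ℝ] ℂ} (hD : AEStronglyMeasurable D) :
    AEMeasurable fun z => ENNReal.ofReal |(D z).det| :=
  ((continuous_abs.comp ContinuousLinearMap.continuous_det).comp_aestronglyMeasurable
    hD).aemeasurable.ennreal_ofReal

/-- An embedding with a weak derivative that is invertible almost everywhere pulls null sets back
to null sets. -/
theorem quasiMeasurePreserving_of_det_ne_zero {f : ℂ → ℂ} {D : ℂ → ℂ →L[ℝ] ℂ}
    (h : HasWeakFDeriv f D) (hf : Topology.IsOpenEmbedding f) (hdet : ∀ᵐ z, (D z).det ≠ 0) :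
    Measure.QuasiMeasurePreserving f volume volume := by
  refine ⟨hf.continuous.measurable, Measure.AbsolutelyContinuous.mk fun s hs h0 => ?_⟩
  rw [Measure.map_apply hf.continuous.measurable hs]
  refine withDensity_absolutelyContinuous' (aemeasurable_det h.locInt'.aestronglyMeasurable)
    (hdet.mono fun z hz => by simpa using hz) (le_antisymm ?_ zero_le)
  refine (withDensity_det_le_comap h hf _).trans ?_
  rw [hf.measurableEmbedding.comap_apply]
  exact (measure_mono (image_preimage_subset f s)).trans_eq h0

/-- The change of variables inequality for nonnegative functions. -/
theorem setLIntegral_comp_mul_det_le {f : ℂ → ℂ} {D : ℂ → ℂ →L[ℝ] ℂ} (h : HasWeakFDeriv f D)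
    (hf : Topology.IsOpenEmbedding f) (hdet : ∀ᵐ z, (D z).det ≠ 0) {k : ℂ → ℝ≥0∞}
    (hk : AEMeasurable k) {B B' : Set ℂ} (hB : MeasurableSet B) (hBB' : MapsTo f B B') :
    ∫⁻ z in B, k (f z) * ENNReal.ofReal |(D z).det| ≤ ∫⁻ w in B', k w := by
  have hq := quasiMeasurePreserving_of_det_ne_zero h hf hdet
  have hfe := hf.measurableEmbedding
  have hJ := aemeasurable_det h.locInt'.aestronglyMeasurable
  have hkf : AEMeasurable fun z => k (f z) := hk.comp_quasiMeasurePreserving hq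
  calc ∫⁻ z in B, k (f z) * ENNReal.ofReal |(D z).det|
      = ∫⁻ z in B, k (f z) ∂volume.withDensity fun z => ENNReal.ofReal |(D z).det| := by
        rw [restrict_withDensity hB,
          lintegral_withDensity_eq_lintegral_mul₀ hJ.restrict hkf.restrict]
        refine lintegral_congr fun z => ?_
        rw [mul_comm]; rfl
    _ ≤ ∫⁻ z in f ⁻¹' B', k (f z) ∂volume.comap f :=
        lintegral_mono' (Measure.restrict_mono hBB' (withDensity_det_le_comap h hf)) le_rfl
    _ = ∫⁻ w in B', k w ∂(volume.comap f).map f := by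
        rw [hfe.restrict_map, hfe.lintegral_map]
    _ ≤ ∫⁻ w in B', k w := by
        rw [hfe.map_comap]
        exact lintegral_mono' (Measure.restrict_mono le_rfl Measure.restrict_le_self) le_rfl

/-- The Cauchy–Schwarz estimate: if `|D|² ≤ K |det D|`, the `L^1` norm of `|H ∘ f| |D|` is
controlled by the `L^2` norm of `H` and the integral of `K`. -/
theorem setLIntegral_comp_mul_enorm_le {f : ℂ → ℂ} {D : ℂ → ℂ →L[ℝ] ℂ} (h : HasWeakFDeriv f D)
    (hf : Topology.IsOpenEmbedding f) (hdet : ∀ᵐ z, (D z).det ≠ 0) {K : ℂ → ℝ≥0∞}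
    (hK : AEMeasurable K) (hDK : ∀ᵐ z, ‖D z‖ₑ ^ 2 ≤ K z * ENNReal.ofReal |(D z).det|)
    {E : Type*} [NormedAddCommGroup E] {H : ℂ → E} (hH : AEStronglyMeasurable H) {B B' : Set ℂ}
    (hB : MeasurableSet B) (hBB' : MapsTo f B B') :
    ∫⁻ z in B, ‖H (f z)‖ₑ * ‖D z‖ₑ ≤
      eLpNorm H 2 (volume.restrict B') * (∫⁻ z in B, K z) ^ (1 / 2 : ℝ) := by
  have hq := quasiMeasurePreserving_of_det_ne_zero h hf hdet
  have hJ := aemeasurable_det h.locInt'.aestronglyMeasurable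
  have hHf : AEMeasurable fun z => ‖H (f z)‖ₑ := (hH.comp_quasiMeasurePreserving hq).enorm
  set J : ℂ → ℝ≥0∞ := fun z => ENNReal.ofReal |(D z).det|
  calc ∫⁻ z in B, ‖H (f z)‖ₑ * ‖D z‖ₑ
      ≤ ∫⁻ z in B, ((fun z => ‖H (f z)‖ₑ * J z ^ (1 / 2 : ℝ)) * fun z => K z ^ (1 / 2 : ℝ)) z := by
        refine lintegral_mono_ae (ae_restrict_of_ae ?_)
        filter_upwards [hDK] with z hz
        simp only [Pi.mul_apply]
        rw [mul_assoc]
        gcongr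
        have := ENNReal.rpow_le_rpow hz (show (0 : ℝ) ≤ 1 / 2 by norm_num)
        rw [ENNReal.mul_rpow_of_nonneg _ _ (by norm_num), ← ENNReal.rpow_natCast,
          ← ENNReal.rpow_mul] at this
        norm_num at this
        rw [mul_comm]
        simpa using this
    _ ≤ (∫⁻ z in B, (‖H (f z)‖ₑ * J z ^ (1 / 2 : ℝ)) ^ (2 : ℝ)) ^ (1 / 2 : ℝ) *
          (∫⁻ z in B, (K z ^ (1 / 2 : ℝ)) ^ (2 : ℝ)) ^ (1 / 2 : ℝ) :=
        ENNReal.lintegral_mul_le_Lp_mul_Lq _ Real.HolderConjugate.two_two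
          (hHf.mul (hJ.pow_const _)).restrict (hK.pow_const _).restrict
    _ = (∫⁻ z in B, ‖H (f z)‖ₑ ^ (2 : ℝ) * J z) ^ (1 / 2 : ℝ) *
          (∫⁻ z in B, K z) ^ (1 / 2 : ℝ) := by
        have e : ∀ a : ℝ≥0∞, (a ^ (1 / 2 : ℝ)) ^ (2 : ℝ) = a := fun a => by
          rw [← ENNReal.rpow_mul]; norm_num
        simp only [e, ENNReal.mul_rpow_of_nonneg _ _ (show (0 : ℝ) ≤ 2 by norm_num)]
    _ ≤ _ := by
        rw [eLpNorm_eq_lintegral_rpow_enorm_toReal (by norm_num) (by norm_num)]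
        simp only [ENNReal.toReal_ofNat]
        gcongr ?_ ^ _ * _
        exact setLIntegral_comp_mul_det_le h hf hdet (hH.enorm.pow_const (2 : ℝ)) hB hBB'

/-- The chain rule for `g ∘ f`, where `f` is an embedding with weak derivative `D` such that
`|D|² ≤ K |det D|` for a locally integrable `K`, and the weak derivative of `g` is in `L^2_loc`. -/
theorem HasWeakFDeriv.comp_embedding {f g : ℂ → ℂ} {D Dg : ℂ → ℂ →L[ℝ] ℂ}
    (h : HasWeakFDeriv f D) (hf : Topology.IsOpenEmbedding f) (hdet : ∀ᵐ z, (D z).det ≠ 0)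
    {K : ℂ → ℝ} (hK : LocallyIntegrable K)
    (hDK : ∀ᵐ z, ‖D z‖ ^ 2 ≤ K z * |(D z).det|) (hg : HasWeakFDeriv g Dg)
    (hDg : ∀ R : ℝ, MemLp Dg 2 (volume.restrict (closedBall 0 R))) :
    HasWeakFDeriv (g ∘ f) fun z => (Dg (f z)).comp (D z) := by
  have hq := quasiMeasurePreserving_of_det_ne_zero h hf hdet
  have hs : ∀ n, ContDiff ℝ ∞ (mollify n g) := fun n => contDiff_mollify n hg.locInt
  have hDs : ∀ n, Continuous (mollify n Dg) := fun n => (contDiff_mollify n hg.locInt').continuous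
  have hDgm := hg.locInt'.aestronglyMeasurable
  have hcompc : Continuous fun p : (ℂ →L[ℝ] ℂ) × (ℂ →L[ℝ] ℂ) => p.1.comp p.2 := by fun_prop
  refine hasWeakFDeriv_of_ae_tendsto (F := fun n => mollify n g ∘ f)
    (G := fun n z => (fderiv ℝ (mollify n g) (f z)).comp (D z))
    (fun n => h.contDiff_comp hf.continuous ((hs n).of_le (by simp)))
    (hg.locInt.aestronglyMeasurable.comp_quasiMeasurePreserving hq)
    (hcompc.comp_aestronglyMeasurable (f := fun z => (Dg (f z), D z))
      ((hDgm.comp_quasiMeasurePreserving hq).prodMk h.locInt'.aestronglyMeasurable))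
    (hq.ae (ae_tendsto_mollify hg.locInt)) fun R => ?_
  obtain ⟨R', hR'⟩ := ((isCompact_closedBall (0 : ℂ) R).image
    hf.continuous).isBounded.subset_closedBall 0
  have hlim := ENNReal.Tendsto.mul_const
    (b := (∫⁻ z in closedBall (0 : ℂ) R, ENNReal.ofReal (K z)) ^ (1 / 2 : ℝ))
    (tendstoLpLoc_mollify (by norm_num) (by norm_num) hDg R') (Or.inr ?_)
  swap
  · refine ENNReal.rpow_ne_top_of_nonneg (by norm_num) (ne_top_of_le_ne_top
      (hK.integrableOn_isCompact (isCompact_closedBall 0 R)).2.ne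
      (lintegral_mono fun z => Real.ofReal_le_enorm _))
  rw [zero_mul] at hlim
  refine tendsto_of_tendsto_of_tendsto_of_le_of_le tendsto_const_nhds hlim (fun _ => zero_le)
    fun n => ?_
  have hcs := setLIntegral_comp_mul_enorm_le h hf hdet (K := fun z => ENNReal.ofReal (K z))
    hK.aestronglyMeasurable.aemeasurable.ennreal_ofReal ?_
    (H := mollify n Dg - Dg) ((hDs n).aestronglyMeasurable.sub hDgm)
    (isClosed_closedBall (x := (0 : ℂ)) (ε := R)).measurableSet
    (mapsTo_iff_image_subset.2 hR')
  · refine le_trans ?_ hcs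
    rw [eLpNorm_one_eq_lintegral_enorm]
    refine lintegral_mono fun z => ?_
    simp only [Pi.sub_apply]
    rw [hg.fderiv_mollify, ← ContinuousLinearMap.sub_comp]
    exact (mollify n Dg (f z) - Dg (f z)).opENorm_comp_le _
  · filter_upwards [hDK] with z hz
    rw [← ENNReal.ofReal_mul' (abs_nonneg _), ← ofReal_norm,
      ← ENNReal.ofReal_pow (norm_nonneg _)]
    exact ENNReal.ofReal_le_ofReal hz

/-- The weak derivative as a real-linear map, assembled from the weak partial derivatives. -/
noncomputable def weakFDeriv (u : ℂ → ℂ) (z : ℂ) : ℂ →L[ℝ] ℂ :=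
  linOf (weakDeriv 1 u z) (weakDeriv Complex.I u z)

theorem MemW1Loc.hasWeakFDeriv {p : ℝ≥0∞} {u : ℂ → ℂ} (h : MemW1Loc p u) :
    HasWeakFDeriv u (weakFDeriv u) := by
  obtain ⟨-, ux, uy, -, -, hx, hy⟩ := h
  exact hx.weakDeriv.hasWeakFDeriv hy.weakDeriv

theorem MemW1Loc.memLp_weakFDeriv {p : ℝ≥0∞} (hp : 1 ≤ p) {u : ℂ → ℂ} (h : MemW1Loc p u) (R : ℝ) :
    MemLp (weakFDeriv u) p (volume.restrict (closedBall 0 R)) := by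
  obtain ⟨-, ux, uy, hux, huy, hx, hy⟩ := h
  refine memLp_linOf hp ((hux _ (isCompact_closedBall 0 R)).ae_eq ?_)
    ((huy _ (isCompact_closedBall 0 R)).ae_eq ?_)
  · exact ae_restrict_of_ae (hx.ae_eq hx.weakDeriv)
  · exact ae_restrict_of_ae (hy.ae_eq hy.weakDeriv)

theorem HasWeakFDeriv.memW1Loc_one {u : ℂ → ℂ} {D : ℂ → ℂ →L[ℝ] ℂ} (h : HasWeakFDeriv u D) :
    MemW1Loc 1 u :=
  ⟨memLpLoc_one_iff.2 h.locInt, fun z => D z 1, fun z => D z Complex.I,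
    memLpLoc_one_iff.2 (h.locInt'.clm_apply 1), memLpLoc_one_iff.2 (h.locInt'.clm_apply Complex.I),
    h.hasWeakDeriv 1, h.hasWeakDeriv Complex.I⟩

theorem HasWeakFDeriv.dz_ae_eq {u : ℂ → ℂ} {D : ℂ → ℂ →L[ℝ] ℂ} (h : HasWeakFDeriv u D) :
    ∀ᵐ z, dz u z = (D z 1 - Complex.I * D z Complex.I) / 2 := by
  filter_upwards [(h.hasWeakDeriv 1).weakDeriv.ae_eq (h.hasWeakDeriv 1),
    (h.hasWeakDeriv Complex.I).weakDeriv.ae_eq (h.hasWeakDeriv Complex.I)] with z h1 hI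
  rw [dz, h1, hI]

theorem HasWeakFDeriv.dzbar_ae_eq {u : ℂ → ℂ} {D : ℂ → ℂ →L[ℝ] ℂ} (h : HasWeakFDeriv u D) :
    ∀ᵐ z, dzbar u z = (D z 1 + Complex.I * D z Complex.I) / 2 := by
  filter_upwards [(h.hasWeakDeriv 1).weakDeriv.ae_eq (h.hasWeakDeriv 1),
    (h.hasWeakDeriv Complex.I).weakDeriv.ae_eq (h.hasWeakDeriv Complex.I)] with z h1 hI
  rw [dzbar, h1, hI]

/-- The weak derivative in terms of the Wirtinger derivatives. -/
theorem weakFDeriv_apply (u : ℂ → ℂ) (z v : ℂ) :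
    weakFDeriv u z v = dz u z * v + dzbar u z * conj v := by
  rw [weakFDeriv, linOf_apply, dz, dzbar]
  apply Complex.ext <;> simp <;> ring

theorem norm_weakFDeriv_le (u : ℂ → ℂ) (z : ℂ) : ‖weakFDeriv u z‖ ≤ ‖dz u z‖ + ‖dzbar u z‖ := by
  refine ContinuousLinearMap.opNorm_le_bound _ (by positivity) fun v => ?_
  rw [weakFDeriv_apply, add_mul]
  refine (norm_add_le _ _).trans_eq ?_
  rw [norm_mul, norm_mul, RCLike.norm_conj]

theorem det_weakFDeriv (u : ℂ → ℂ) (z : ℂ) : (weakFDeriv u z).det = jacobian u z := by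
  have h1 : (weakFDeriv u z).det = (weakDeriv 1 u z).re * (weakDeriv Complex.I u z).im -
      (weakDeriv Complex.I u z).re * (weakDeriv 1 u z).im := by
    rw [ContinuousLinearMap.det, ← LinearMap.det_toMatrix Complex.basisOneI, Matrix.det_fin_two]
    simp [LinearMap.toMatrix_apply, weakFDeriv, linOf_apply]
  rw [h1, jacobian, ← Complex.normSq_eq_norm_sq, ← Complex.normSq_eq_norm_sq, dz, dzbar,
    Complex.normSq_apply, Complex.normSq_apply]
  simp
  ring

/-- The dilatation bounds the squared operator norm of the derivative by a multiple of the
Jacobian: `|Df|² ≤ (|f_z| + |f_z̄|)² = K J_f`. -/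
theorem norm_weakFDeriv_sq_le {f : ℂ → ℂ} {z : ℂ} (hJ : 0 < jacobian f z) :
    ‖weakFDeriv f z‖ ^ 2 ≤ dilatation f z * |(weakFDeriv f z).det| := by
  rw [det_weakFDeriv, abs_of_pos hJ]
  have hlt : ‖dzbar f z‖ < ‖dz f z‖ := by
    rw [jacobian] at hJ
    exact lt_of_pow_lt_pow_left₀ 2 (norm_nonneg _) (by linarith)
  have hpos : 0 < ‖dz f z‖ := (norm_nonneg _).trans_lt hlt
  have hne : dz f z ≠ 0 := norm_pos_iff.1 hpos
  have hsub : ‖dz f z‖ - ‖dzbar f z‖ ≠ 0 := by linarith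
  have hK : dilatation f z * jacobian f z = (‖dz f z‖ + ‖dzbar f z‖) ^ 2 := by
    rw [dilatation, complexCharacteristic, if_pos hne, norm_div, jacobian]
    field_simp
    ring
  rw [hK]
  exact pow_le_pow_left₀ (norm_nonneg _) (norm_weakFDeriv_le f z) 2

end Beltrami

theorem proposition2p2 (f : ℂ → ℂ) (hf : Beltrami.IsRegularHomeo f)
    (hsense : Beltrami.SensePreserving f)
    (hK : LocallyIntegrable (Beltrami.dilatation f) volume)
    (g : ℂ → ℂ) (hg : Beltrami.MemW1Loc 2 g) :
    Beltrami.MemW1Loc 1 (g ∘ f) ∧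
    (∀ᵐ z : ℂ, Beltrami.dz (g ∘ f) z =
      Beltrami.dz g (f z) * Beltrami.dz f z
        + Beltrami.dzbar g (f z) * conj (Beltrami.dzbar f z)) ∧
    (∀ᵐ z : ℂ, Beltrami.dzbar (g ∘ f) z =
      Beltrami.dz g (f z) * Beltrami.dzbar f z
        + Beltrami.dzbar g (f z) * conj (Beltrami.dz f z)) := by
  have hdet : ∀ᵐ z, (Beltrami.weakFDeriv f z).det ≠ 0 :=
    hf.jacobian_pos.mono fun z hz => by
      rw [Beltrami.det_weakFDeriv]; exact hz.ne'
  have h := hf.sobolev.hasWeakFDeriv.comp_embedding hf.homeo hdet hK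
    (hf.jacobian_pos.mono fun z hz => Beltrami.norm_weakFDeriv_sq_le hz) hg.hasWeakFDeriv
    (hg.memLp_weakFDeriv (by norm_num))
  refine ⟨h.memW1Loc_one, h.dz_ae_eq.mono fun z hz => ?_, h.dzbar_ae_eq.mono fun z hz => ?_⟩
  all_goals
    rw [hz]
    simp only [ContinuousLinearMap.comp_apply, Beltrami.weakFDeriv_apply, map_add, map_mul, map_neg,
      map_one, Complex.conj_I]
    ring_nf
    simp only [Complex.I_sq]
    ring
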